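/- For $n\ge 1$ let $\mathbb K_n=\{\tau\in\mathbb R^n:\tau_1<\dots<\tau_n\}$ be the set of knot vectors, and for $p\ge 0$ and $\tau\in\mathbb K_{p+2}$ let $$B_p(\tau)(x)=(\tau_{p+2}-\tau_1)\,[\tau_1,\dots,\tau_{p+2}]\,(\bullet-x)_+^p$$ be the B-spline of degree $p$ with knots $\tau$ (divided difference of the truncated power; $t_+^0=1$ for $t>0$ and $0$ otherwise). Let $I\subset\mathbb R$ be an interval. For an integer $n\ge 0$, $H^n(I)$ is the usual Sobolev space of functions with weak derivatives up to order $n$ in $L^2(I)$, and for $n\ge 1$, $H^{-n}(I)$ is the dual space of $H^n(I)$; likewise for $\mathbb R$. For $f\in H^{-n}(I)$, $n\ge 1$, and $g\in H^n(I)$, $\int_I fg\,dx$ denotes the duality pairing. Let $k\ge 0$ and $p,q\ge k$ be integers with $(p,q)\ne(k,k)$, let $r=\min(p-k-1,\,q-k)$, let $f\in H^{-r}(I)$ and $\sigma\in\mathbb K_{q+2}$. Then $$F(\tau)=\int_I f\,(\partial_x^kB_p(\tau))\,(\partial_x^kB_q(\sigma))\,dx$$ is well defined for every $\tau\in\mathbb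 K_{p+2}$. Let $\tau\in\mathbb K_{p+2}$ and, only in the case $p=k$ (so that $r=-1$ and $f\in H^1(I)$), assume that the limit of $f\,\partial_x^kB_q(\sigma)$ from within $I$ is zero at every endpoint of $I$ that is one of the knots $\tau_1,\dots,\tau_{p+2}$. Then $F$ is differentiable at $\tau$, and for every $i\in\{1,\dots,p+2\}$ the partial derivative $\partial_i\partial_x^kB_p(\tau)$ with respect to the $i$-th knot exists in the topology of $H^{p-k-1}(\mathbb R)$, and $$\partial_iF(\tau)=\int_I f\,(\partial_i\partial_x^kB_p(\tau))\,(\partial_x^kB_q(\sigma))\,dx.$$ Here, if $p=k$, $\partial_i\partial_x^kB_p(\tau)\in H^{-1}(\mathbb R)$ is a finite signed measure, and the right-hand side is the integral of the continuous function $f\,\partial_x^kB_q(\sigma)$ over the interior of $I$ with respect to this measure. -/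

import Mathlib

open MeasureTheory Filter Topology Set
open scoped ContDiff

noncomputable section

/-! ### Knot vectors and B-splines -/

/-- Knot vectors with `n` knots: strictly increasing real sequences of length `n`. -/
def KnotVectors (n : ℕ) : Set (Fin n → ℝ) := {τ | StrictMono τ}

/-- The truncated power `t ↦ t_+^p`; for `p = 0` it is the indicator function of `t > 0`. -/
def truncPow (p : ℕ) (t : ℝ) : ℝ := if 0 < t then t ^ p else 0

/-- The divided difference `[τ₁, …, τₙ] g` at pairwise distinct nodes. -/
def divDiff {n : ℕ} (τ : Fin n → ℝ) (g : ℝ → ℝ) : ℝ :=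
  ∑ i, g (τ i) / ∏ j ∈ Finset.univ.erase i, (τ i - τ j)

/-- The B-spline functor
`B_p(τ)(x) = (τ_{p+2} - τ_1) [τ_1, …, τ_{p+2}] (• - x)_+^p`. -/
def bspline (p : ℕ) (τ : Fin (p + 2) → ℝ) (x : ℝ) : ℝ :=
  (τ (Fin.last (p + 1)) - τ 0) * divDiff τ (fun y => truncPow p (y - x))

/-- The `k`-th spatial derivative `∂_x^k B_p(τ)`, for `k ≤ p`. Since `B_p(τ)` is of class `C^{p-1}`
and piecewise polynomial, the classical derivative exists (for `k = p`: off the knots) and is the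
weak derivative. -/
def bsplineDeriv (k p : ℕ) (τ : Fin (p + 2) → ℝ) : ℝ → ℝ := iteratedDeriv k (bspline p τ)

/-! ### Sobolev spaces of integer order on an interval -/

/-- A product of an `L²` function and a continuous compactly supported function is integrable. -/
theorem integrable_Lp_mul_test (I : Set ℝ) (w : Lp ℝ 2 (volume.restrict I)) {φ : ℝ → ℝ}
    (hφ : Continuous φ) (hc : HasCompactSupport φ) :
    Integrable (fun x => w x * φ x) (volume.restrict I) :=
  (Lp.memLp w).integrable_mul (q := 2) (hφ.memLp_of_hasCompactSupport hc)

/-- `H^n(I)` for `n ≥ 0`, as the space of all tuples `(w₀, w₁, …, w_n)` of functions in `L²(I)`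
such that `w_{j+1}` is the weak derivative of `w_j` on the interior of `I`. An element is determined
by `w₀`, and the norm is `(∑_j ‖w_j‖²_{L²(I)})^{1/2}`. -/
def sobolevNat (I : Set ℝ) (n : ℕ) :
    Submodule ℝ (PiLp 2 (fun _ : Fin (n + 1) => Lp ℝ 2 (volume.restrict I))) where
  carrier := {w | ∀ (j : Fin n) (φ : ℝ → ℝ), ContDiff ℝ ∞ φ → HasCompactSupport φ →
    tsupport φ ⊆ interior I →
    ∫ x in I, w j.castSucc x * deriv φ x = -∫ x in I, w j.succ x * φ x}
  zero_mem' := by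
    intro j φ _ _ _
    have h : ∀ ψ : ℝ → ℝ,
        ∫ x in I, (0 : Lp ℝ 2 (volume.restrict I)) x * ψ x = 0 := by
      intro ψ
      rw [integral_congr_ae (g := fun _ => (0 : ℝ)), integral_zero]
      filter_upwards [Lp.coeFn_zero ℝ 2 (volume.restrict I)] with x hx
      rw [hx, Pi.zero_apply, zero_mul]
    simp only [PiLp.zero_apply, h, neg_zero]
  add_mem' := by
    intro a b ha hb j φ h1 h2 h3
    have key : ∀ (u v : Lp ℝ 2 (volume.restrict I)) (ψ : ℝ → ℝ), Continuous ψ →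
        HasCompactSupport ψ → ∫ x in I, (u + v) x * ψ x
          = (∫ x in I, u x * ψ x) + ∫ x in I, v x * ψ x := by
      intro u v ψ hψ hc
      rw [← integral_add (integrable_Lp_mul_test I u hψ hc) (integrable_Lp_mul_test I v hψ hc)]
      refine integral_congr_ae ?_
      filter_upwards [Lp.coeFn_add u v] with x hx
      rw [hx, Pi.add_apply, add_mul]
    have hd : Continuous (deriv φ) := h1.continuous_deriv (by simp)
    simp only [PiLp.add_apply]
    rw [key _ _ _ hd h2.deriv, key _ _ _ h1.continuous h2, ha j φ h1 h2 h3, hb j φ h1 h2 h3]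
    ring
  smul_mem' := by
    intro c a ha j φ h1 h2 h3
    have key : ∀ (u : Lp ℝ 2 (volume.restrict I)) (ψ : ℝ → ℝ),
        ∫ x in I, (c • u) x * ψ x = c * ∫ x in I, u x * ψ x := by
      intro u ψ
      rw [← integral_const_mul]
      refine integral_congr_ae ?_
      filter_upwards [Lp.coeFn_smul c u] with x hx
      rw [hx, Pi.smul_apply, smul_eq_mul, mul_assoc]
    simp only [PiLp.smul_apply]
    rw [key, key, ha j φ h1 h2 h3]
    ring

/-- `H^s(I)` for an integer `s`: for `s < 0` it is the dual space of `H^{-s}(I)`. -/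
def Sobolev (I : Set ℝ) : ℤ → Type
  | Int.ofNat n => sobolevNat I n
  | Int.negSucc n => StrongDual ℝ (sobolevNat I (n + 1))

instance (I : Set ℝ) (s : ℤ) : NormedAddCommGroup (Sobolev I s) :=
  match s with
  | Int.ofNat n => inferInstanceAs (NormedAddCommGroup (sobolevNat I n))
  | Int.negSucc n => inferInstanceAs (NormedAddCommGroup (StrongDual ℝ (sobolevNat I (n + 1))))

instance (I : Set ℝ) (s : ℤ) : NormedSpace ℝ (Sobolev I s) :=
  match s with
  | Int.ofNat n => inferInstanceAs (NormedSpace ℝ (sobolevNat I n))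
  | Int.negSucc n => inferInstanceAs (NormedSpace ℝ (StrongDual ℝ (sobolevNat I (n + 1))))

/-- `w ∈ H^s(I)` is (the class of) the function `g`. For `s < 0` this means that `g ∈ L²(I)` and that
`w` is the functional `φ ↦ ∫_I g φ dx`. -/
def IsClassOf (I : Set ℝ) : (s : ℤ) → Sobolev I s → (ℝ → ℝ) → Prop
  | Int.ofNat _, (w : sobolevNat I _), g => w.1 0 =ᵐ[volume.restrict I] g
  | Int.negSucc n, (w : StrongDual ℝ (sobolevNat I (n + 1))), g =>
      MemLp g 2 (volume.restrict I) ∧ ∀ φ : sobolevNat I (n + 1), w φ = ∫ x in I, g x * φ.1 0 x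

/-- `∫_I f g dx` is well defined and equal to `a`, for `f ∈ H^s(I)` and a function `g`. For `s ≥ 0`
it is a Lebesgue integral; for `s < 0` the function `g` has to be in `H^{-s}(I)` and the integral is
the duality pairing of `f` and `g`. -/
def HasPairing (I : Set ℝ) : (s : ℤ) → Sobolev I s → (ℝ → ℝ) → ℝ → Prop
  | Int.ofNat _, (f : sobolevNat I _), g, a =>
      IntegrableOn (fun x => f.1 0 x * g x) I ∧ ∫ x in I, f.1 0 x * g x = a
  | Int.negSucc n, (f : StrongDual ℝ (sobolevNat I (n + 1))), g, a =>
      ∃ w : sobolevNat I (n + 1), w.1 0 =ᵐ[volume.restrict I] g ∧ f w = a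

/-- `∫_I f T v dx` is well defined and equal to `a`, for `f ∈ H^s(I)`, `T ∈ H^m(ℝ)` and a function
`v`. For `m ≥ 0` it is the integral over `I` of `f` against the function `T v`. For `m < 0` the
distribution `T` has to be a finite signed measure `μ - ν`, and the integral is that of `f v` over
the interior of `I` with respect to this measure, with `f` taken continuous there. -/
def HasTriplePairing (I : Set ℝ) (s : ℤ) (f : Sobolev I s) :
    (m : ℤ) → Sobolev univ m → (ℝ → ℝ) → ℝ → Prop
  | Int.ofNat _, (T : sobolevNat univ _), v, a => HasPairing I s f (fun x => T.1 0 x * v x) a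
  | Int.negSucc n, (T : StrongDual ℝ (sobolevNat univ (n + 1))), v, a =>
      ∃ (μ ν : Measure ℝ) (_ : IsFiniteMeasure μ) (_ : IsFiniteMeasure ν) (g : ℝ → ℝ),
        (∀ (φ : ℝ → ℝ) (w : sobolevNat univ (n + 1)), ContDiff ℝ ∞ φ → HasCompactSupport φ →
          w.1 0 =ᵐ[volume.restrict univ] φ → T w = (∫ x, φ x ∂μ) - ∫ x, φ x ∂ν) ∧
        ContinuousOn g (interior I) ∧ IsClassOf I s f g ∧
        IntegrableOn (fun x => g x * v x) (interior I) μ ∧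
        IntegrableOn (fun x => g x * v x) (interior I) ν ∧
        (∫ x in interior I, g x * v x ∂μ) - (∫ x in interior I, g x * v x ∂ν) = a

/-- `T ∈ H^m(ℝ)` is the partial derivative `∂_i ∂_x^k B_p(τ)` with respect to the `i`-th knot, in the
topology of `H^m(ℝ)`. -/
def IsKnotDeriv (k p : ℕ) (m : ℤ) (i : Fin (p + 2)) (τ : Fin (p + 2) → ℝ)
    (T : Sobolev univ m) : Prop :=
  ∃ U : ℝ → Sobolev univ m,
    (∀ᶠ t in 𝓝 (τ i), IsClassOf univ m (U t) (bsplineDeriv k p (Function.update τ i t))) ∧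
    HasDerivAt U T (τ i)

/-- The (essential) limit of `f v` at `x` from within `I` exists and is zero, `f ∈ H^s(I)`. -/
def ProductVanishesAt (I : Set ℝ) (s : ℤ) (f : Sobolev I s) (v : ℝ → ℝ) (x : ℝ) : Prop :=
  ∀ g : ℝ → ℝ, IsClassOf I s f g →
    Tendsto (fun y => g y * v y) (𝓝 x ⊓ ae (volume.restrict I)) (𝓝 0)

end

/-! ### Truncated powers and explicit formulas for derivatives of B-splines -/

/-! Off the knots, `∂_x^k B_p(τ)` is a constant times `∑ j, c_j(τ) (τ_j - x)_+^(p-k)`, with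
coefficients `c_j` rational in the knots (`splineSum`, `knotCoeff`). Everything therefore reduces to
the way a single truncated power depends on its knot. A truncated power is not square integrable on
`ℝ`, so it is cut off at some `A` to the left of all knots. The cut-off does not change the sum,
because divided differences annihilate polynomials of low degree (`sum_knotCoeff_mul_pow`,
`splineSum_eq_sum_cutPow`).

Case `p > k`. A cut-off power of degree `l + 1` is differentiable in its knot with values in `L²`,
with derivative `l + 1` times the power of degree `l` (`hasDerivAt_cutPowLp`). Hence `∂_x^n B_p` is
differentiable in `L²(ℝ)` for every `n < p`, and `∂_x^k B_p` is differentiable in `H^(p-k-1)(ℝ)`. By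
the Leibniz rule, the weak derivatives up to order `r` of the product of the two splines only
involve `∂_x^(k+a) B_p` with `k + a < p` and `∂_x^(k+b) B_q` with `k + b ≤ q`. The latter are
bounded functions, and multiplication by them is a bounded operator on `L²`, so the product is
differentiable in `H^r(I)` (`exists_product_sobolevNat`). The bounded functional `f` preserves this.

Case `p = k`. The indicator function of `(A, t)` is not differentiable in `L²` with respect to `t`.
Integration by parts shows that it is differentiable as a functional on `H¹(ℝ)`, with the evaluation
at `t` as derivative (`IsDerivPair.dualCLM_cutPowLp_eq`). So the knot derivative is a combination of
Lebesgue measures on `(A, τ_j)` and a Dirac measure at `τ_i`. On the other side, `F` is a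
combination of integrals of `f ∂_x^k B_q(σ)`, extended by zero from the interior of `I`, over `(A,
τ_j)`. These are differentiable in `τ_j` away from the endpoints of `I` by continuity, and at an
endpoint by the vanishing assumption (`hasDerivAt_integral_indicator_interior`). The same product
rule `hasDerivAt_sum_knotCoeff_smul` computes both derivatives, which is why they agree. -/

theorem truncPow_succ_eq (l : ℕ) (t : ℝ) : truncPow (l + 1) t = max t 0 ^ (l + 1) := by
  unfold truncPow
  split_ifs with h
  · rw [max_eq_left h.le]
  · rw [max_eq_right (not_lt.mp h), zero_pow l.succ_ne_zero]

theorem continuous_truncPow_succ (l : ℕ) : Continuous (truncPow (l + 1)) := by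
  rw [funext (truncPow_succ_eq l)]
  fun_prop

theorem measurable_truncPow (l : ℕ) : Measurable (truncPow l) :=
  Measurable.ite measurableSet_Ioi (by fun_prop) measurable_const

theorem truncPow_of_nonpos (l : ℕ) {t : ℝ} (ht : t ≤ 0) : truncPow l t = 0 :=
  if_neg (not_lt.mpr ht)

theorem truncPow_of_pos (l : ℕ) {t : ℝ} (ht : 0 < t) : truncPow l t = t ^ l :=
  if_pos ht

theorem abs_truncPow_le (l : ℕ) {t R : ℝ} (hR : 0 ≤ R) (ht : t ≤ R) :
    |truncPow l t| ≤ R ^ l := by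
  rcases le_or_gt t 0 with h | h
  · rw [truncPow_of_nonpos l h, abs_zero]
    positivity
  · rw [truncPow_of_pos l h, abs_of_nonneg (by positivity)]
    gcongr

theorem abs_truncPow_succ_sub_le (l : ℕ) {s t R : ℝ} (hR : 0 ≤ R) (hs : s ≤ R) (ht : t ≤ R) :
    |truncPow (l + 1) s - truncPow (l + 1) t| ≤ (l + 1) * R ^ l * |s - t| := by
  rw [truncPow_succ_eq, truncPow_succ_eq]
  have h1 := abs_pow_sub_pow_le (max s 0) (max t 0) (l + 1)
  have h2 : |max s 0 - max t 0| ≤ |s - t| := abs_max_sub_max_le_abs s t 0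
  have h3 : max |max s 0| |max t 0| ≤ R := by
    rw [abs_of_nonneg (le_max_right s 0), abs_of_nonneg (le_max_right t 0)]
    simp [hR, hs, ht]
  refine h1.trans ?_
  rw [Nat.add_sub_cancel]
  push_cast
  calc |max s 0 - max t 0| * ((l : ℝ) + 1) * max |max s 0| |max t 0| ^ l
      ≤ |s - t| * ((l : ℝ) + 1) * R ^ l := by gcongr
    _ = _ := by ring

/-- Only `t = 0` needs care: for `l ≥ 1` the power `t ^ (l + 1)` is `o(t)` there, whereas for `l =
0` there is a genuine kink. -/
theorem hasDerivAt_truncPow_succ (l : ℕ) (t : ℝ) (h : l ≠ 0 ∨ t ≠ 0) :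
    HasDerivAt (truncPow (l + 1)) ((l + 1) * truncPow l t) t := by
  rcases lt_trichotomy t 0 with ht | rfl | ht
  · rw [truncPow_of_nonpos l ht.le, mul_zero]
    refine (hasDerivAt_const t (0 : ℝ)).congr_of_eventuallyEq ?_
    filter_upwards [Iio_mem_nhds ht] with s hs
    exact truncPow_of_nonpos _ (le_of_lt hs)
  · obtain ⟨n, rfl⟩ := Nat.exists_eq_succ_of_ne_zero (h.resolve_right (by simp))
    rw [truncPow_of_nonpos _ le_rfl, mul_zero, hasDerivAt_iff_isLittleO_nhds_zero]
    simp only [zero_add, truncPow_of_nonpos _ (le_refl (0 : ℝ)), sub_zero, smul_zero]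
    refine Asymptotics.IsBigO.trans_isLittleO (g := fun x : ℝ => x ^ (n + 2)) ?_ ?_
    · refine Asymptotics.IsBigO.of_bound 1 (Eventually.of_forall fun x => ?_)
      rw [one_mul]
      rcases le_or_gt x 0 with hx | hx
      · rw [truncPow_of_nonpos _ hx, norm_zero]
        positivity
      · rw [truncPow_of_pos _ hx]
    · simpa using Asymptotics.isLittleO_pow_pow (𝕜 := ℝ) (show 1 < n + 2 by omega)
  · rw [truncPow_of_pos l ht]
    have := hasDerivAt_pow (l + 1) t
    rw [Nat.add_sub_cancel] at this
    push_cast at this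
    refine this.congr_of_eventuallyEq ?_
    filter_upwards [Ioi_mem_nhds ht] with s hs
    exact truncPow_of_pos _ hs

/-- The coefficient of `(τ_j - x)_+^p` in the B-spline with knots `τ`. -/
noncomputable def knotCoeff (p : ℕ) (τ : Fin (p + 2) → ℝ) (j : Fin (p + 2)) : ℝ :=
  (τ (Fin.last (p + 1)) - τ 0) / ∏ l ∈ Finset.univ.erase j, (τ j - τ l)

/-- The explicit formula for the `n`-th derivative of a B-spline of degree `p`. -/
noncomputable def splineSum (n p : ℕ) (τ : Fin (p + 2) → ℝ) (x : ℝ) : ℝ :=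
  (-1) ^ n * p.descFactorial n * ∑ j, knotCoeff p τ j * truncPow (p - n) (τ j - x)

theorem bspline_eq_splineSum (p : ℕ) (τ : Fin (p + 2) → ℝ) : bspline p τ = splineSum 0 p τ := by
  funext x
  simp only [bspline, divDiff, splineSum, knotCoeff, Finset.mul_sum, pow_zero,
    Nat.descFactorial_zero, Nat.cast_one, one_mul, Nat.sub_zero]
  exact Finset.sum_congr rfl fun j _ => by ring

/-- For `n + 1 = p` the sum is piecewise linear, so the knots have to be avoided; for smaller `n`
the summands are `C¹`. -/
theorem hasDerivAt_splineSum {n p : ℕ} (hn : n < p) (τ : Fin (p + 2) → ℝ) (x : ℝ)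
    (h : n + 1 < p ∨ x ∉ range τ) :
    HasDerivAt (splineSum n p τ) (splineSum (n + 1) p τ x) x := by
  obtain ⟨l, rfl⟩ : ∃ l, p = n + (l + 1) := ⟨p - n - 1, by omega⟩
  have key : ∀ j, HasDerivAt (fun x => truncPow (l + 1) (τ j - x))
      (((l + 1) * truncPow l (τ j - x)) * (-1)) x := by
    intro j
    refine (hasDerivAt_truncPow_succ l (τ j - x) ?_).comp x ((hasDerivAt_id x).const_sub (τ j))
    rcases h with h | h
    · left; omega
    · right
      intro h0
      exact h ⟨j, by linarith⟩
  have e1 : n + (l + 1) - n = l + 1 := by omega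
  have e2 : n + (l + 1) - (n + 1) = l := by omega
  have := (HasDerivAt.fun_sum fun j (_ : j ∈ Finset.univ) =>
    (key j).const_mul (knotCoeff (n + (l + 1)) τ j)).const_mul
      ((-1) ^ n * ((n + (l + 1)).descFactorial n : ℝ))
  have e3 : splineSum n (n + (l + 1)) τ = fun x => (-1) ^ n * ((n + (l + 1)).descFactorial n : ℝ) *
      ∑ j, knotCoeff (n + (l + 1)) τ j * truncPow (l + 1) (τ j - x) := by
    funext x
    rw [splineSum, e1]
  rw [e3]
  refine this.congr_deriv ?_
  rw [splineSum, e2, Nat.descFactorial_succ, e1, Finset.mul_sum, Finset.mul_sum]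
  refine Finset.sum_congr rfl fun j _ => ?_
  push_cast
  ring

theorem continuous_splineSum {n p : ℕ} (hn : n < p) (τ : Fin (p + 2) → ℝ) :
    Continuous (splineSum n p τ) := by
  unfold splineSum
  obtain ⟨l, hl⟩ : ∃ l, p - n = l + 1 := ⟨p - n - 1, by omega⟩
  rw [hl]
  have := continuous_truncPow_succ l
  fun_prop

theorem measurable_splineSum (n p : ℕ) (τ : Fin (p + 2) → ℝ) : Measurable (splineSum n p τ) := by
  unfold splineSum
  have := measurable_truncPow (p - n)
  fun_prop

theorem bsplineDeriv_eq_splineSum {n p : ℕ} (hn : n < p) (τ : Fin (p + 2) → ℝ) :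
    bsplineDeriv n p τ = splineSum n p τ := by
  induction n with
  | zero => rw [bsplineDeriv, iteratedDeriv_zero, bspline_eq_splineSum]
  | succ n ih =>
    have ih' := ih (by omega)
    rw [bsplineDeriv] at ih' ⊢
    rw [iteratedDeriv_succ, ih']
    funext x
    exact (hasDerivAt_splineSum (by omega) τ x (Or.inl hn)).deriv

theorem bsplineDeriv_eq_splineSum_of_notMem {n p : ℕ} (hn : n ≤ p) (τ : Fin (p + 2) → ℝ) {x : ℝ}
    (hx : x ∉ range τ) : bsplineDeriv n p τ x = splineSum n p τ x := by
  rcases hn.lt_or_eq with h | rfl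
  · rw [bsplineDeriv_eq_splineSum h]
  · cases n with
    | zero => rw [bsplineDeriv, iteratedDeriv_zero, bspline_eq_splineSum]
    | succ n =>
      have := bsplineDeriv_eq_splineSum (n := n) n.lt_succ_self τ
      rw [bsplineDeriv] at this ⊢
      rw [iteratedDeriv_succ, this]
      exact (hasDerivAt_splineSum n.lt_succ_self τ x (Or.inr hx)).deriv

theorem ae_notMem_range {N : ℕ} (τ : Fin N → ℝ) (I : Set ℝ) :
    ∀ᵐ x ∂(volume.restrict I), x ∉ range τ :=
  ae_restrict_of_ae (measure_eq_zero_iff_ae_notMem.mp ((finite_range τ).measure_zero volume))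

theorem bsplineDeriv_ae_eq {n p : ℕ} (hn : n ≤ p) (τ : Fin (p + 2) → ℝ) (I : Set ℝ) :
    bsplineDeriv n p τ =ᵐ[volume.restrict I] splineSum n p τ := by
  filter_upwards [ae_notMem_range τ I] with x hx
  exact bsplineDeriv_eq_splineSum_of_notMem hn τ hx

/-- Up to the factor `τ_{p+2} - τ_1`, the sum is the divided difference of a polynomial of degree `l
≤ p` at `p + 2` nodes. This is its coefficient of degree `p + 1`, hence zero. -/
theorem sum_knotCoeff_mul_pow {p l : ℕ} (hl : l ≤ p) {τ : Fin (p + 2) → ℝ}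
    (hτ : τ ∈ KnotVectors (p + 2)) (x : ℝ) : ∑ j, knotCoeff p τ j * (τ j - x) ^ l = 0 := by
  classical
  have hdeg : ((Polynomial.X - Polynomial.C x : Polynomial ℝ) ^ l).degree = l := by
    rw [Polynomial.degree_pow, Polynomial.degree_X_sub_C, nsmul_one]
  have h := Lagrange.coeff_eq_sum (s := Finset.univ) (v := τ)
    (P := (Polynomial.X - Polynomial.C x) ^ l) (hτ.injective.injOn) (by
      rw [hdeg, Finset.card_univ, Fintype.card_fin]
      exact_mod_cast (by omega : l < p + 2))
  rw [Polynomial.coeff_eq_zero_of_degree_lt (by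
    rw [hdeg, Finset.card_univ, Fintype.card_fin]
    exact_mod_cast (by omega : l < p + 2 - 1))] at h
  have : ∑ j, knotCoeff p τ j * (τ j - x) ^ l = (τ (Fin.last (p + 1)) - τ 0) *
      ∑ i, Polynomial.eval (τ i) ((Polynomial.X - Polynomial.C x) ^ l) /
        ∏ j ∈ Finset.univ.erase i, (τ i - τ j) := by
    rw [Finset.mul_sum]
    refine Finset.sum_congr rfl fun j _ => ?_
    rw [knotCoeff]
    simp only [Polynomial.eval_pow, Polynomial.eval_sub, Polynomial.eval_X, Polynomial.eval_C]
    ring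
  rw [this, ← h, mul_zero]

/-- The truncated power `x ↦ (t - x)_+^l`, cut off at the left of `A`. -/
noncomputable def cutPow (A : ℝ) (l : ℕ) (t x : ℝ) : ℝ :=
  if A < x then truncPow l (t - x) else 0

/-- This is the compact support of B-splines on the left: it makes each summand square integrable
without changing the sum. -/
theorem splineSum_eq_sum_cutPow {n p : ℕ} {τ : Fin (p + 2) → ℝ}
    (hτ : τ ∈ KnotVectors (p + 2)) {A : ℝ} (hA : A < τ 0) (x : ℝ) :
    splineSum n p τ x =
      (-1) ^ n * p.descFactorial n * ∑ j, knotCoeff p τ j * cutPow A (p - n) (τ j) x := by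
  rw [splineSum]
  congr 1
  by_cases hx : A < x
  · simp only [cutPow, if_pos hx]
  · simp only [cutPow, if_neg hx, mul_zero, Finset.sum_const_zero]
    -- To the left of all knots every truncated power is the full power, so the sum is one of the
    -- vanishing moments.
    rw [← sum_knotCoeff_mul_pow (Nat.sub_le p n) hτ x]
    refine Finset.sum_congr rfl fun j _ => ?_
    rw [truncPow_of_pos]
    have := hτ.monotone (Fin.zero_le j)
    linarith [not_lt.mp hx]

theorem measurable_cutPow (A : ℝ) (l : ℕ) (t : ℝ) : Measurable (cutPow A l t) :=
  Measurable.ite measurableSet_Ioi ((measurable_truncPow l).comp (by fun_prop)) measurable_const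

theorem cutPow_of_notMem (A : ℝ) (l : ℕ) {t x : ℝ} (hx : x ∉ Ioo A t) : cutPow A l t x = 0 := by
  unfold cutPow
  split_ifs with h
  · exact truncPow_of_nonpos _ (by
      by_contra h'
      exact hx ⟨h, by linarith⟩)
  · rfl

theorem abs_cutPow_le (A : ℝ) (l : ℕ) (t x : ℝ) : |cutPow A l t x| ≤ |t - A| ^ l := by
  unfold cutPow
  split_ifs with h
  · exact abs_truncPow_le l (abs_nonneg _) (by linarith [le_abs_self (t - A)])
  · rw [abs_zero]
    positivity

theorem exists_abs_splineSum_le {n p : ℕ} {τ : Fin (p + 2) → ℝ} (hτ : τ ∈ KnotVectors (p + 2)) :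
    ∃ K, ∀ x, |splineSum n p τ x| ≤ K := by
  refine ⟨|(-1) ^ n * (p.descFactorial n : ℝ)| *
    ∑ j, |knotCoeff p τ j| * |τ j - (τ 0 - 1)| ^ (p - n), fun x => ?_⟩
  rw [splineSum_eq_sum_cutPow hτ (A := τ 0 - 1) (by linarith), abs_mul]
  gcongr
  refine (Finset.abs_sum_le_sum_abs _ _).trans (Finset.sum_le_sum fun j _ => ?_)
  rw [abs_mul]
  gcongr
  exact abs_cutPow_le _ _ _ _

theorem differentiableAt_knotCoeff {p : ℕ} {τ : Fin (p + 2) → ℝ}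
    (hτ : τ ∈ KnotVectors (p + 2)) (j : Fin (p + 2)) :
    DifferentiableAt ℝ (fun τ => knotCoeff p τ j) τ := by
  unfold knotCoeff
  have h : DifferentiableAt ℝ
      (fun τ : Fin (p + 2) → ℝ => ∏ l ∈ Finset.univ.erase j, (τ j - τ l)) τ := by
    refine (HasFDerivAt.finsetProd fun l _ => DifferentiableAt.hasFDerivAt ?_).differentiableAt
    fun_prop
  have h0 : DifferentiableAt ℝ (fun τ : Fin (p + 2) → ℝ => τ (Fin.last (p + 1)) - τ 0) τ := by
    fun_prop
  simp only [div_eq_mul_inv]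
  refine h0.fun_mul (h.fun_inv ?_)
  refine Finset.prod_ne_zero_iff.mpr fun l hl => ?_
  exact sub_ne_zero.mpr fun h => (Finset.ne_of_mem_erase hl) (hτ.injective h).symm

theorem isOpen_knotVectors (N : ℕ) : IsOpen (KnotVectors N) := by
  have : KnotVectors N = ⋂ i : Fin N, ⋂ j : Fin N, ⋂ _ : i < j, {τ | τ i < τ j} := by
    ext τ
    simp [KnotVectors, StrictMono]
  rw [this]
  exact isOpen_iInter_of_finite fun i => isOpen_iInter_of_finite fun j =>
    isOpen_iInter_of_finite fun _ => isOpen_lt (continuous_apply i) (continuous_apply j)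

/-! ### Differentiability of cut-off truncated powers in `L²` -/

theorem memLp_cutPow (A : ℝ) (l : ℕ) (t : ℝ) (I : Set ℝ) :
    MemLp (cutPow A l t) 2 (volume.restrict I) := by
  have h1 : MemLp (indicator (Ioo A t) fun _ => |t - A| ^ l) 2 (volume.restrict I) :=
    memLp_indicator_const 2 measurableSet_Ioo _
      (Or.inr ((Measure.restrict_apply_le I _).trans_lt measure_Ioo_lt_top).ne)
  refine h1.mono (measurable_cutPow A l t).aestronglyMeasurable (Eventually.of_forall fun x => ?_)
  by_cases hx : x ∈ Ioo A t
  · rw [indicator_of_mem hx, Real.norm_eq_abs]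
    exact (abs_cutPow_le A l t x).trans (le_abs_self _)
  · rw [cutPow_of_notMem A l hx, norm_zero]
    positivity

/-- The class in `L²(I)` of a cut-off truncated power. -/
noncomputable def cutPowLp (I : Set ℝ) (A : ℝ) (l : ℕ) (t : ℝ) : Lp ℝ 2 (volume.restrict I) :=
  (memLp_cutPow A l t I).toLp

theorem coeFn_cutPowLp (I : Set ℝ) (A : ℝ) (l : ℕ) (t : ℝ) :
    cutPowLp I A l t =ᵐ[volume.restrict I] cutPow A l t :=
  (memLp_cutPow A l t I).coeFn_toLp

/-- Dominated convergence in `L²`. -/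
theorem tendsto_toLp_of_dominated {α ι : Type*} [MeasurableSpace α] {μ : Measure α} {l : Filter ι}
    [l.IsCountablyGenerated] {F : ι → α → ℝ} {g bd : α → ℝ} (hF : ∀ i, MemLp (F i) 2 μ)
    (hg : MemLp g 2 μ) (hb : MemLp bd 2 μ) (hbd : ∀ᶠ i in l, ∀ᵐ x ∂μ, |F i x - g x| ≤ bd x)
    (hlim : ∀ᵐ x ∂μ, Tendsto (fun i => F i x) l (𝓝 (g x))) :
    Tendsto (fun i => (hF i).toLp (F i)) l (𝓝 (hg.toLp g)) := by
  rw [Lp.tendsto_Lp_iff_tendsto_eLpNorm'']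
  have hsq : Tendsto (fun i => ∫⁻ x, ‖F i x - g x‖ₑ ^ (2 : ℝ) ∂μ) l (𝓝 (∫⁻ _, 0 ∂μ)) := by
    refine tendsto_lintegral_filter_of_dominated_convergence' (fun x => ‖bd x‖ₑ ^ (2 : ℝ)) ?_ ?_ ?_ ?_
    · exact Eventually.of_forall fun i =>
        ((hF i).aestronglyMeasurable.sub hg.aestronglyMeasurable).enorm.pow_const _
    · filter_upwards [hbd] with i hi
      filter_upwards [hi] with x hx
      gcongr
      rw [enorm_le_iff_norm_le]
      exact hx.trans (le_abs_self _)
    · have := hb.eLpNorm_lt_top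
      rw [eLpNorm_lt_top_iff_lintegral_rpow_enorm_lt_top (by simp) (by simp)] at this
      simpa using this.ne
    · filter_upwards [hlim] with x hx
      have h1 : Tendsto (fun i => F i x - g x) l (𝓝 0) := by
        simpa using hx.sub_const (g x)
      have h2 := (ENNReal.continuous_rpow_const (y := 2)).tendsto _ |>.comp h1.enorm
      simpa [Function.comp_def] using h2
  have h3 := (ENNReal.continuous_rpow_const (y := 1 / 2)).tendsto _ |>.comp hsq
  simp only [lintegral_zero] at h3
  rw [ENNReal.zero_rpow_of_pos (by norm_num)] at h3
  refine h3.congr fun i => ?_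
  rw [eLpNorm_eq_lintegral_rpow_enorm_toReal (by simp) (by simp)]
  simp

/-- The difference quotients are uniformly bounded and supported in a fixed bounded interval, and
they converge pointwise except possibly at `x = t`. Dominated convergence in `L²` then applies; for
`l = 0` the limit jumps at `t`, which is harmless. -/
theorem hasDerivAt_cutPowLp (I : Set ℝ) (A : ℝ) (l : ℕ) (t : ℝ) :
    HasDerivAt (cutPowLp I A (l + 1)) ((l + 1 : ℝ) • cutPowLp I A l t) t := by
  rw [hasDerivAt_iff_tendsto_slope]
  have hF : ∀ u, MemLp (fun x => (u - t)⁻¹ * (cutPow A (l + 1) u x - cutPow A (l + 1) t x)) 2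
      (volume.restrict I) := fun u =>
    ((memLp_cutPow A (l + 1) u I).sub (memLp_cutPow A (l + 1) t I)).const_mul _
  have hg : MemLp (fun x => (l + 1 : ℝ) * cutPow A l t x) 2 (volume.restrict I) :=
    (memLp_cutPow A l t I).const_mul _
  have e1 : slope (cutPowLp I A (l + 1)) t = fun u => (hF u).toLp _ := by
    funext u
    rw [slope_def_module]
    rfl
  have e2 : (l + 1 : ℝ) • cutPowLp I A l t = hg.toLp _ := rfl
  rw [e1, e2]
  -- For `x > A` and `u < t + 1`, both `u - x` and `t - x` are at most `R`, so `(l + 1) * R ^ l` is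
  -- a Lipschitz constant for the quotients. The second summand of `K` bounds the limit.
  set R : ℝ := |t - A| + 1 with hR
  have hR0 : 0 ≤ R := by positivity
  set K : ℝ := (l + 1) * R ^ l + (l + 1) * |t - A| ^ l with hK
  have hK0 : 0 ≤ K := by positivity
  refine tendsto_toLp_of_dominated hF hg (bd := indicator (Ioo A (t + 1)) fun _ => K) ?_ ?_ ?_
  · exact memLp_indicator_const 2 measurableSet_Ioo _
      (Or.inr ((Measure.restrict_apply_le I _).trans_lt measure_Ioo_lt_top).ne)
  · have h1 : ∀ᶠ u in 𝓝[≠] t, u ∈ Iio (t + 1) :=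
      mem_nhdsWithin_of_mem_nhds (Iio_mem_nhds (by linarith))
    filter_upwards [h1, self_mem_nhdsWithin] with u hu hne
    have hne' : 0 < |u - t| := abs_pos.mpr (sub_ne_zero.mpr hne)
    refine Eventually.of_forall fun x => ?_
    by_cases hx : x ∈ Ioo A (t + 1)
    · rw [indicator_of_mem hx]
      refine (abs_sub _ _).trans (add_le_add ?_ ?_)
      · rw [abs_mul, abs_inv, inv_mul_le_iff₀ hne']
        unfold cutPow
        rw [if_pos hx.1, if_pos hx.1]
        have hx1 := hx.1
        have hu1 : u < t + 1 := hu
        have := abs_truncPow_succ_sub_le l (s := u - x) (t := t - x) hR0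
          (by linarith [le_abs_self (t - A)]) (by linarith [le_abs_self (t - A)])
        rw [sub_sub_sub_cancel_right] at this
        linarith
      · rw [abs_mul, abs_of_nonneg (by positivity)]
        gcongr
        exact abs_cutPow_le A l t x
    · rw [indicator_of_notMem hx]
      have hu1 : u < t + 1 := hu
      have h2 : x ∉ Ioo A u := fun h => hx ⟨h.1, h.2.trans hu1⟩
      have h3 : x ∉ Ioo A t := fun h => hx ⟨h.1, by linarith [h.2]⟩
      simp [cutPow_of_notMem A _ h2, cutPow_of_notMem A _ h3]
  · have h1 : ∀ᵐ x ∂(volume.restrict I), x ≠ t := by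
      refine ae_restrict_of_ae ?_
      simp [ae_iff]
    filter_upwards [h1] with x hx
    by_cases hA : A < x
    · simp only [cutPow, if_pos hA]
      have h2 : HasDerivAt (fun u => truncPow (l + 1) (u - x)) ((l + 1) * truncPow l (t - x)) t := by
        have := (hasDerivAt_truncPow_succ l (t - x)
          (Or.inr (sub_ne_zero.mpr (Ne.symm hx)))).comp t ((hasDerivAt_id t).sub_const x)
        simpa only [Function.comp_def, mul_one, id_eq] using this
      rw [hasDerivAt_iff_tendsto_slope] at h2
      refine h2.congr fun u => ?_
      rw [slope_def_module, smul_eq_mul]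
    · simp only [cutPow, if_neg hA]
      simp

/-! ### Primitives of locally integrable functions -/

/-- `h` is a primitive of the locally integrable function `h'`. -/
structure IsPrimitive (h h' : ℝ → ℝ) : Prop where
  locallyIntegrable : LocallyIntegrable h' volume
  integral_eq : ∀ a b : ℝ, ∫ x in a..b, h' x = h b - h a

namespace IsPrimitive

variable {h h' g g' : ℝ → ℝ}

theorem intervalIntegrable (H : IsPrimitive h h') (a b : ℝ) : IntervalIntegrable h' volume a b :=
  intervalIntegrable_iff.mpr
    ((H.locallyIntegrable.integrableOn_isCompact isCompact_uIcc).mono_set uIoc_subset_uIcc)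

theorem eq_add_integral (H : IsPrimitive h h') (a : ℝ) : h = fun x => h a + ∫ t in a..x, h' t := by
  funext x
  rw [H.integral_eq]
  ring

theorem ae_hasDerivAt (H : IsPrimitive h h') : ∀ᵐ x, HasDerivAt h (h' x) x := by
  filter_upwards [LocallyIntegrable.ae_hasDerivAt_integral H.locallyIntegrable] with x hx
  rw [H.eq_add_integral 0]
  exact (hx 0).const_add _

theorem absolutelyContinuousOnInterval (H : IsPrimitive h h') (a b : ℝ) :
    AbsolutelyContinuousOnInterval h a b := by
  have h1 := (H.intervalIntegrable a b).absolutelyContinuousOnInterval_intervalIntegral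
    (c := a) (by simp)
  have h2 : AbsolutelyContinuousOnInterval (fun _ : ℝ => h a) a b :=
    (LipschitzWith.const (h a)).lipschitzOnWith.absolutelyContinuousOnInterval
  rw [H.eq_add_integral a]
  exact h2.add h1

theorem continuous (H : IsPrimitive h h') : Continuous h := by
  rw [continuous_iff_continuousAt]
  intro x
  refine ((H.absolutelyContinuousOnInterval (x - 1) (x + 1)).continuousOn).continuousAt ?_
  rw [uIcc_of_le (by linarith)]
  exact Icc_mem_nhds (by linarith) (by linarith)

/-- Primitives of locally integrable functions are absolutely continuous, and their classical
derivatives agree a.e. with the given ones. Splines with kinks are thus covered. -/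
theorem integral_mul_eq (H : IsPrimitive h h') (G : IsPrimitive g g') (a b : ℝ) :
    ∫ x in a..b, h x * g' x = h b * g b - h a * g a - ∫ x in a..b, h' x * g x := by
  have := (H.absolutelyContinuousOnInterval a b).integral_mul_deriv_eq_deriv_mul
    (G.absolutelyContinuousOnInterval a b)
  have e1 : ∫ x in a..b, h x * deriv g x = ∫ x in a..b, h x * g' x := by
    refine intervalIntegral.integral_congr_ae ?_
    filter_upwards [G.ae_hasDerivAt] with x hx _
    rw [hx.deriv]
  have e2 : ∫ x in a..b, deriv h x * g x = ∫ x in a..b, h' x * g x := by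
    refine intervalIntegral.integral_congr_ae ?_
    filter_upwards [H.ae_hasDerivAt] with x hx _
    rw [hx.deriv]
  rw [← e1, this, e2]

theorem of_hasDerivAt (hd : ∀ x, HasDerivAt h (h' x) x) (hc : Continuous h') : IsPrimitive h h' :=
  ⟨hc.locallyIntegrable, fun a b =>
    intervalIntegral.integral_eq_sub_of_hasDerivAt (fun x _ => hd x) (hc.intervalIntegrable a b)⟩

theorem of_hasDerivAt_off_countable {s : Set ℝ} (hs : s.Countable) (hc : Continuous h)
    (hd : ∀ x ∉ s, HasDerivAt h (h' x) x) (hi : LocallyIntegrable h' volume) :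
    IsPrimitive h h' :=
  ⟨hi, fun _ _ => integral_eq_of_hasDerivAt_off_countable h h' hs hc.continuousOn
    (fun x hx => hd x hx.2) (intervalIntegrable_iff.mpr
      ((hi.integrableOn_isCompact isCompact_uIcc).mono_set uIoc_subset_uIcc))⟩

theorem of_locallyIntegrable (hi : LocallyIntegrable h' volume) (c a : ℝ) :
    IsPrimitive (fun x => c + ∫ t in a..x, h' t) h' := by
  have hI : ∀ a b, IntervalIntegrable h' volume a b := fun a b => intervalIntegrable_iff.mpr
    ((hi.integrableOn_isCompact isCompact_uIcc).mono_set uIoc_subset_uIcc)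
  refine ⟨hi, fun u v => ?_⟩
  rw [add_sub_add_left_eq_sub, intervalIntegral.integral_interval_sub_left (hI _ _) (hI _ _)]

/-- A function vanishing off a bounded interval has the same integral over that interval. -/
theorem _root_.integral_eq_intervalIntegral_of_forall_notMem {f : ℝ → ℝ} {a b : ℝ} (hab : a ≤ b)
    (hf : ∀ x, x ∉ Ioc a b → f x = 0) : ∫ x, f x = ∫ x in a..b, f x := by
  rw [intervalIntegral.integral_of_le hab, setIntegral_eq_integral_of_forall_compl_eq_zero hf]

theorem _root_.exists_tsupport_subset_Ioo {φ : ℝ → ℝ} (hφ : HasCompactSupport φ) :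
    ∃ a b, a ≤ b ∧ tsupport φ ⊆ Ioo a b := by
  obtain ⟨R, hR⟩ := hφ.isCompact.isBounded.subset_closedBall 0
  refine ⟨-(|R| + 1), |R| + 1, by linarith [abs_nonneg R], fun x hx => ?_⟩
  have := hR hx
  rw [Metric.mem_closedBall, dist_zero_right, Real.norm_eq_abs] at this
  have h2 := abs_le.mp (this.trans (le_abs_self R))
  exact ⟨by linarith, by linarith⟩

theorem integral_mul_deriv_test (H : IsPrimitive h h') {φ : ℝ → ℝ} (hφ : ContDiff ℝ ∞ φ)
    (hc : HasCompactSupport φ) : ∫ x, h x * deriv φ x = -∫ x, h' x * φ x := by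
  obtain ⟨a, b, hab, hs⟩ := exists_tsupport_subset_Ioo hc
  have h0 : ∀ x, x ∉ Ioo a b → φ x = 0 := fun x hx =>
    image_eq_zero_of_notMem_tsupport fun h => hx (hs h)
  have h1 : ∀ x, x ∉ Ioo a b → deriv φ x = 0 := fun x hx =>
    image_eq_zero_of_notMem_tsupport fun h => hx (hs (tsupport_deriv_subset h))
  have G : IsPrimitive φ (deriv φ) :=
    of_hasDerivAt (fun x => (hφ.differentiable (by simp) x).hasDerivAt)
      (hφ.continuous_deriv (by simp))
  rw [integral_eq_intervalIntegral_of_forall_notMem hab (fun x hx => by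
      rw [h1 x fun h => hx (Ioo_subset_Ioc_self h), mul_zero]),
    integral_eq_intervalIntegral_of_forall_notMem hab (fun x hx => by
      rw [h0 x fun h => hx (Ioo_subset_Ioc_self h), mul_zero]),
    H.integral_mul_eq G, h0 a (by simp), h0 b (by simp)]
  simp

theorem setIntegral_mul_deriv_test (H : IsPrimitive h h') {I : Set ℝ} {φ : ℝ → ℝ}
    (hφ : ContDiff ℝ ∞ φ) (hc : HasCompactSupport φ) (hI : tsupport φ ⊆ interior I) :
    ∫ x in I, h x * deriv φ x = -∫ x in I, h' x * φ x := by
  have hs := hI.trans interior_subset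
  rw [setIntegral_eq_integral_of_forall_compl_eq_zero, H.integral_mul_deriv_test hφ hc,
    setIntegral_eq_integral_of_forall_compl_eq_zero]
  · intro x hx
    rw [image_eq_zero_of_notMem_tsupport fun h => hx (hs h), mul_zero]
  · intro x hx
    rw [image_eq_zero_of_notMem_tsupport fun h => hx (hs (tsupport_deriv_subset h)), mul_zero]

theorem const_mul (H : IsPrimitive h h') (c : ℝ) :
    IsPrimitive (fun x => c * h x) (fun x => c * h' x) :=
  ⟨H.locallyIntegrable.smul c, fun a b => by
    rw [intervalIntegral.integral_const_mul, H.integral_eq, mul_sub]⟩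

theorem mul (H : IsPrimitive h h') (G : IsPrimitive g g') :
    IsPrimitive (fun x => h x * g x) (fun x => h' x * g x + h x * g' x) := by
  refine ⟨LocallyIntegrable.add ?_ ?_, fun a b => ?_⟩
  · simpa only [smul_eq_mul, mul_comm] using
      H.locallyIntegrable.continuous_smul G.continuous
  · exact G.locallyIntegrable.continuous_smul H.continuous
  · rw [intervalIntegral.integral_add, H.integral_mul_eq G]
    · ring
    · exact (H.intervalIntegrable a b).mul_continuousOn G.continuous.continuousOn
    · exact (G.intervalIntegrable a b).continuousOn_mul H.continuous.continuousOn

theorem sum {ι : Type*} (s : Finset ι) {u u' : ι → ℝ → ℝ} (H : ∀ i ∈ s, IsPrimitive (u i) (u' i)) :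
    IsPrimitive (fun x => ∑ i ∈ s, u i x) (fun x => ∑ i ∈ s, u' i x) := by
  refine ⟨locallyIntegrable_finsetSum s fun i hi => (H i hi).locallyIntegrable, fun a b => ?_⟩
  rw [intervalIntegral.integral_finsetSum fun i hi => (H i hi).intervalIntegrable a b,
    ← Finset.sum_sub_distrib]
  exact Finset.sum_congr rfl fun i hi => (H i hi).integral_eq a b

end IsPrimitive

theorem locallyIntegrable_of_bounded {g : ℝ → ℝ} (hg : Measurable g) {K : ℝ}
    (hK : ∀ x, |g x| ≤ K) : LocallyIntegrable g volume :=
  (locallyIntegrable_const K).mono hg.aestronglyMeasurable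
    (Eventually.of_forall fun x => (hK x).trans (le_abs_self K))

/-- This includes `n + 1 = p`, where the derivative jumps at the knots: it exists off a finite set
and is bounded. -/
theorem isPrimitive_splineSum {n p : ℕ} (hn : n < p) {τ : Fin (p + 2) → ℝ}
    (hτ : τ ∈ KnotVectors (p + 2)) : IsPrimitive (splineSum n p τ) (splineSum (n + 1) p τ) := by
  obtain ⟨K, hK⟩ := exists_abs_splineSum_le (n := n + 1) hτ
  exact IsPrimitive.of_hasDerivAt_off_countable (finite_range τ).countable
    (continuous_splineSum hn τ) (fun x hx => hasDerivAt_splineSum hn τ x (Or.inr hx))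
    (locallyIntegrable_of_bounded (measurable_splineSum _ _ _) hK)

/-! ### Functionals and multipliers on `L²` and on Sobolev spaces -/

theorem inner_toLp_eq_integral {α : Type*} [MeasurableSpace α] {μ : Measure α} {g : α → ℝ}
    (hg : MemLp g 2 μ) (u : Lp ℝ 2 μ) : inner ℝ (hg.toLp g) u = ∫ x, u x * g x ∂μ := by
  rw [L2.inner_def]
  refine integral_congr_ae ?_
  filter_upwards [hg.coeFn_toLp] with x hx
  simp [hx]

/-- Each defining condition equates two inner products with fixed elements of `L²(I)`, hence is
closed. -/
theorem isClosed_sobolevNat (I : Set ℝ) (n : ℕ) :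
    IsClosed (sobolevNat I n : Set (PiLp 2 (fun _ : Fin (n + 1) => Lp ℝ 2 (volume.restrict I)))) := by
  have : (sobolevNat I n : Set (PiLp 2 (fun _ : Fin (n + 1) => Lp ℝ 2 (volume.restrict I)))) =
      {w | ∀ (j : Fin n) (φ : ℝ → ℝ), ContDiff ℝ ∞ φ → HasCompactSupport φ →
        tsupport φ ⊆ interior I →
        ∫ x in I, w j.castSucc x * deriv φ x = -∫ x in I, w j.succ x * φ x} := rfl
  rw [this]
  simp only [ofPred_forall]
  refine isClosed_iInter fun j => isClosed_iInter fun φ => isClosed_iInter fun h1 =>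
    isClosed_iInter fun h2 => isClosed_iInter fun _ => ?_
  have m1 : MemLp φ 2 (volume.restrict I) := h1.continuous.memLp_of_hasCompactSupport h2
  have m2 : MemLp (deriv φ) 2 (volume.restrict I) :=
    (h1.continuous_deriv (by simp)).memLp_of_hasCompactSupport h2.deriv
  simp_rw [← inner_toLp_eq_integral m1, ← inner_toLp_eq_integral m2]
  refine isClosed_eq ?_ ?_ <;> fun_prop

instance (I : Set ℝ) (n : ℕ) : CompleteSpace (sobolevNat I n) :=
  (isClosed_sobolevNat I n).completeSpace_coe

/-- Differentiability in the ambient product is checked coordinatewise. The orthogonal projection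
onto the closed subspace is bounded, linear and the identity on it, so it carries differentiability
over to the subspace. -/
theorem differentiableAt_sobolevNat {E : Type*} [NormedAddCommGroup E] [NormedSpace ℝ E]
    {I : Set ℝ} {n : ℕ} {U : E → sobolevNat I n} {x : E}
    (h : ∀ j, DifferentiableAt ℝ (fun e => (U e).1 j) x) : DifferentiableAt ℝ U x := by
  have h1 : DifferentiableAt ℝ (fun e => (U e).1) x := (differentiableAt_piLp 2).mpr h
  have h2 := (sobolevNat I n).orthogonalProjectionOnto.differentiableAt.comp x h1
  refine h2.congr_of_eventuallyEq (Eventually.of_forall fun e => ?_)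
  exact ((sobolevNat I n).orthogonalProjectionOnto_mem_subspace_eq_self (U e)).symm

theorem exists_multiplier (I : Set ℝ) {g : ℝ → ℝ} (hg : Measurable g) {K : ℝ}
    (hK : ∀ x, |g x| ≤ K) :
    ∃ M : Lp ℝ 2 (volume.restrict (univ : Set ℝ)) →L[ℝ] Lp ℝ 2 (volume.restrict I),
      ∀ u, M u =ᵐ[volume.restrict I] fun x => u x * g x := by
  have hle : volume.restrict I ≤ volume.restrict (univ : Set ℝ) :=
    Measure.restrict_mono_set volume (subset_univ I)
  have hm : ∀ u : Lp ℝ 2 (volume.restrict (univ : Set ℝ)),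
      MemLp (fun x => u x * g x) 2 (volume.restrict I) := fun u =>
    MemLp.of_le_mul ((Lp.memLp u).mono_measure hle)
      (((Lp.memLp u).mono_measure hle).aestronglyMeasurable.mul hg.aestronglyMeasurable)
      (Eventually.of_forall fun x => by
        rw [norm_mul, mul_comm]
        exact mul_le_mul_of_nonneg_right (hK x) (norm_nonneg _))
  have hac := Measure.absolutelyContinuous_of_le hle
  refine ⟨LinearMap.mkContinuous
    { toFun := fun u => (hm u).toLp
      map_add' := fun u v => ?_
      map_smul' := fun c u => ?_ } K fun u => ?_, fun u => (hm u).coeFn_toLp⟩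
  · refine Lp.ext ?_
    filter_upwards [(hm (u + v)).coeFn_toLp, (hm u).coeFn_toLp, (hm v).coeFn_toLp,
      hac.ae_le (Lp.coeFn_add u v), Lp.coeFn_add ((hm u).toLp) ((hm v).toLp)] with x h1 h2 h3 h4 h5
    rw [h1, h5, Pi.add_apply, h2, h3, h4, Pi.add_apply, add_mul]
  · refine Lp.ext ?_
    filter_upwards [(hm (c • u)).coeFn_toLp, (hm u).coeFn_toLp,
      hac.ae_le (Lp.coeFn_smul c u), Lp.coeFn_smul c ((hm u).toLp)] with x h1 h2 h4 h5
    rw [h1, RingHom.id_apply, h5, Pi.smul_apply, h2, h4, Pi.smul_apply, smul_eq_mul, smul_eq_mul,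
      mul_assoc]
  · have hu : MemLp u 2 (volume.restrict I) := (Lp.memLp u).mono_measure hle
    have h1 : ‖(hm u).toLp‖ ≤ K * ‖hu.toLp‖ := by
      refine Lp.norm_le_mul_norm_of_ae_le_mul ?_
      filter_upwards [(hm u).coeFn_toLp, hu.coeFn_toLp] with x h1 h2
      rw [h1, h2, norm_mul, mul_comm]
      exact mul_le_mul_of_nonneg_right (hK x) (norm_nonneg _)
    refine h1.trans (mul_le_mul_of_nonneg_left ?_ ((abs_nonneg _).trans (hK 0)))
    rw [Lp.norm_toLp, Lp.norm_def]
    exact ENNReal.toReal_mono (Lp.eLpNorm_ne_top u) (eLpNorm_mono_measure _ hle)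

/-- Integration against an element of a Sobolev space of non-positive order is a bounded
functional. -/
theorem exists_pairing_functional (I : Set ℝ) (n : ℕ) (f : Sobolev I (-(n : ℤ))) :
    ∃ L : StrongDual ℝ (sobolevNat I n), ∀ (w : sobolevNat I n) (g : ℝ → ℝ),
      w.1 0 =ᵐ[volume.restrict I] g → HasPairing I (-(n : ℤ)) f g (L w) := by
  cases n with
  | zero =>
    let f' : sobolevNat I 0 := f
    let P : sobolevNat I 0 →L[ℝ] Lp ℝ 2 (volume.restrict I) :=
      (PiLp.proj 2 _ 0).comp (sobolevNat I 0).subtypeL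
    refine ⟨(innerSL ℝ (f'.1 0)).comp P, fun w g hw => ?_⟩
    change IntegrableOn (fun x => f'.1 0 x * g x) I ∧ ∫ x in I, f'.1 0 x * g x = inner ℝ (f'.1 0) (w.1 0)
    have e : (fun x => f'.1 0 x * g x) =ᵐ[volume.restrict I] fun x => f'.1 0 x * w.1 0 x := by
      filter_upwards [hw] with x hx
      rw [hx]
    refine ⟨((Lp.memLp (f'.1 0)).integrable_mul (q := 2) (Lp.memLp (w.1 0))).congr e.symm, ?_⟩
    rw [integral_congr_ae e, L2.inner_def]
    simp [mul_comm]
  | succ n => exact ⟨f, fun w g hw => ⟨w, hw, rfl⟩⟩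

/-! ### Derivatives of B-splines as elements of `L²`, depending on the knots -/

/-- The class in `L²(ℝ)` of the `n`-th derivative of a B-spline, with a cut-off at `A`, which is
immaterial for `A < τ 0`. -/
noncomputable def cutSplineLp (A : ℝ) (n p : ℕ) (τ : Fin (p + 2) → ℝ) :
    Lp ℝ 2 (volume.restrict (univ : Set ℝ)) :=
  ((-1) ^ n * p.descFactorial n : ℝ) •
    ∑ j, knotCoeff p τ j • cutPowLp univ A (p - n) (τ j)

theorem coeFn_sum_smul {ι α : Type*} [MeasurableSpace α] {μ : Measure α} (s : Finset ι)
    (c : ι → ℝ) (u : ι → Lp ℝ 2 μ) (g : ι → α → ℝ) (h : ∀ i ∈ s, u i =ᵐ[μ] g i) :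
    (∑ i ∈ s, c i • u i : Lp ℝ 2 μ) =ᵐ[μ] fun x => ∑ i ∈ s, c i * g i x := by
  classical
  induction s using Finset.induction_on with
  | empty =>
    simp only [Finset.sum_empty]
    exact Lp.coeFn_zero ℝ 2 μ
  | insert i s hi ih =>
    have ih' := ih fun j hj => h j (Finset.mem_insert_of_mem hj)
    rw [Finset.sum_insert hi]
    filter_upwards [Lp.coeFn_add (c i • u i) (∑ j ∈ s, c j • u j), Lp.coeFn_smul (c i) (u i),
      h i (Finset.mem_insert_self i s), ih'] with x h1 h2 h3 h4
    rw [h1, Pi.add_apply, h2, Pi.smul_apply, h3, h4, Finset.sum_insert hi, smul_eq_mul]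

theorem coeFn_cutSplineLp {A : ℝ} {n p : ℕ} {τ : Fin (p + 2) → ℝ}
    (hτ : τ ∈ KnotVectors (p + 2)) (hA : A < τ 0) :
    cutSplineLp A n p τ =ᵐ[volume.restrict univ] splineSum n p τ := by
  have h1 := coeFn_sum_smul Finset.univ (knotCoeff p τ)
    (fun j => cutPowLp univ A (p - n) (τ j)) (fun j => cutPow A (p - n) (τ j))
    (fun j _ => coeFn_cutPowLp univ A (p - n) (τ j))
  filter_upwards [h1, Lp.coeFn_smul ((-1) ^ n * p.descFactorial n : ℝ)
    (∑ j, knotCoeff p τ j • cutPowLp univ A (p - n) (τ j))] with x hx1 hx2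
  rw [cutSplineLp, hx2, Pi.smul_apply, hx1, splineSum_eq_sum_cutPow hτ hA, smul_eq_mul]

/-- The class in `L²(ℝ)` of the `n`-th derivative of a B-spline. -/
noncomputable def splineLp (n p : ℕ) (τ : Fin (p + 2) → ℝ) :
    Lp ℝ 2 (volume.restrict (univ : Set ℝ)) :=
  cutSplineLp (τ 0 - 1) n p τ

theorem coeFn_splineLp {n p : ℕ} {τ : Fin (p + 2) → ℝ} (hτ : τ ∈ KnotVectors (p + 2)) :
    splineLp n p τ =ᵐ[volume.restrict univ] splineSum n p τ :=
  coeFn_cutSplineLp hτ (by linarith)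

theorem eventually_mem_knotVectors {N : ℕ} {τ : Fin N → ℝ} (hτ : τ ∈ KnotVectors N) :
    ∀ᶠ τ' in 𝓝 τ, τ' ∈ KnotVectors N :=
  (isOpen_knotVectors N).mem_nhds hτ

theorem differentiableAt_splineLp {n p : ℕ} (hn : n < p) {τ : Fin (p + 2) → ℝ}
    (hτ : τ ∈ KnotVectors (p + 2)) : DifferentiableAt ℝ (splineLp n p) τ := by
  obtain ⟨l, hl⟩ : ∃ l, p - n = l + 1 := ⟨p - n - 1, by omega⟩
  -- The cut-off in `splineLp` moves with the knots. It is frozen here at its value for `τ`, which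
  -- gives the same class for all nearby knot vectors.
  have h1 : DifferentiableAt ℝ (cutSplineLp (τ 0 - 1) n p) τ := by
    unfold cutSplineLp
    rw [hl]
    refine DifferentiableAt.fun_const_smul (𝕜 := ℝ) ?_ _
    refine DifferentiableAt.fun_sum fun j _ => ?_
    refine (differentiableAt_knotCoeff hτ j).fun_smul ?_
    have h2 : DifferentiableAt ℝ (fun τ : Fin (p + 2) → ℝ => τ j) τ := by fun_prop
    exact ((hasDerivAt_cutPowLp univ (τ 0 - 1) l (τ j)).differentiableAt).comp τ h2
  refine h1.congr_of_eventuallyEq ?_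
  have h2 : ∀ᶠ τ' : Fin (p + 2) → ℝ in 𝓝 τ, τ 0 - 1 < τ' 0 :=
    (continuous_apply 0).continuousAt.eventually_const_lt (by simp)
  filter_upwards [eventually_mem_knotVectors hτ, h2] with τ' h3 h4
  exact Lp.ext ((coeFn_splineLp h3).trans (coeFn_cutSplineLp h3 h4).symm)

theorem mem_sobolevNat_of_isPrimitive {I : Set ℝ} {n : ℕ}
    {w : PiLp 2 (fun _ : Fin (n + 1) => Lp ℝ 2 (volume.restrict I))} {H : ℕ → ℝ → ℝ}
    (hw : ∀ j : Fin (n + 1), w j =ᵐ[volume.restrict I] H j)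
    (hH : ∀ j < n, IsPrimitive (H j) (H (j + 1))) : w ∈ sobolevNat I n := by
  intro j φ h1 h2 h3
  have e1 : ∫ x in I, w j.castSucc x * deriv φ x = ∫ x in I, H j x * deriv φ x := by
    refine integral_congr_ae ?_
    filter_upwards [hw j.castSucc] with x hx
    rw [hx, Fin.val_castSucc]
  have e2 : ∫ x in I, w j.succ x * φ x = ∫ x in I, H (j + 1) x * φ x := by
    refine integral_congr_ae ?_
    filter_upwards [hw j.succ] with x hx
    rw [hx, Fin.val_succ]
  rw [e1, e2]
  exact (hH j j.2).setIntegral_mul_deriv_test h1 h2 h3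

open Classical in
/-- The `k`-th derivative of a B-spline as an element of `H^m(ℝ)`, for knot vectors. -/
noncomputable def splineSobolev (k m p : ℕ) (hm : k + m < p) (τ : Fin (p + 2) → ℝ) :
    sobolevNat univ m :=
  if hτ : τ ∈ KnotVectors (p + 2) then
    ⟨WithLp.toLp 2 fun j : Fin (m + 1) => splineLp (k + j) p τ,
      mem_sobolevNat_of_isPrimitive (H := fun j => splineSum (k + j) p τ)
        (fun _ => coeFn_splineLp hτ)
        (fun _ _ => isPrimitive_splineSum (by omega) hτ)⟩
  else 0

theorem splineSobolev_apply {k m p : ℕ} (hm : k + m < p) {τ : Fin (p + 2) → ℝ}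
    (hτ : τ ∈ KnotVectors (p + 2)) (j : Fin (m + 1)) :
    (splineSobolev k m p hm τ).1 j = splineLp (k + j) p τ := by
  rw [splineSobolev, dif_pos hτ]

theorem differentiableAt_splineSobolev {k m p : ℕ} (hm : k + m < p) {τ : Fin (p + 2) → ℝ}
    (hτ : τ ∈ KnotVectors (p + 2)) : DifferentiableAt ℝ (splineSobolev k m p hm) τ := by
  refine differentiableAt_sobolevNat fun j => ?_
  refine (differentiableAt_splineLp (n := k + j) (by omega) hτ).congr_of_eventuallyEq ?_
  filter_upwards [eventually_mem_knotVectors hτ] with τ' h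
  exact splineSobolev_apply hm h j

/-! ### Products of derivatives of two B-splines in `H^n(I)` -/

/-- The `j`-th derivative of a product of `k`-th derivatives of B-splines, by the Leibniz rule. -/
noncomputable def leibnizSum (k p q : ℕ) (τ : Fin (p + 2) → ℝ) (σ : Fin (q + 2) → ℝ) (j : ℕ)
    (x : ℝ) : ℝ :=
  ∑ a ∈ Finset.HasAntidiagonal.antidiagonal j,
    (j.choose a.1 : ℝ) * (splineSum (k + a.1) p τ x * splineSum (k + a.2) q σ x)

/-- The product rule applied to each summand, regrouped by Pascal's identity. -/
theorem isPrimitive_leibnizSum {k p q j : ℕ} (hp : k + j < p) (hq : k + j < q)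
    {τ : Fin (p + 2) → ℝ} (hτ : τ ∈ KnotVectors (p + 2)) {σ : Fin (q + 2) → ℝ}
    (hσ : σ ∈ KnotVectors (q + 2)) :
    IsPrimitive (leibnizSum k p q τ σ j) (leibnizSum k p q τ σ (j + 1)) := by
  have h1 := IsPrimitive.sum (Finset.HasAntidiagonal.antidiagonal j) fun a ha => by
    have ha' := Finset.HasAntidiagonal.mem_antidiagonal.mp ha
    exact ((isPrimitive_splineSum (n := k + a.1) (by omega) hτ).mul
      (isPrimitive_splineSum (n := k + a.2) (by omega) hσ)).const_mul (j.choose a.1 : ℝ)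
  convert h1 using 1
  · rfl
  funext x
  rw [leibnizSum, Finset.sum_antidiagonal_choose_succ_mul
    (fun a b => splineSum (k + a) p τ x * splineSum (k + b) q σ x), ← Finset.sum_add_distrib]
  refine Finset.sum_congr rfl fun a ha => ?_
  rw [← Nat.choose_symm_of_eq_add (Finset.HasAntidiagonal.mem_antidiagonal.mp ha).symm]
  simp only [← add_assoc]
  ring

/-- In an appropriate Sobolev space on `I`, the product of the `k`-th derivatives of two B-splines
depends differentiably on the knots of the first one. -/
theorem exists_product_sobolevNat (I : Set ℝ) {k p q n : ℕ} (hp : k + n < p) (hq : k + n ≤ q)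
    {σ : Fin (q + 2) → ℝ} (hσ : σ ∈ KnotVectors (q + 2)) :
    ∃ (W : (Fin (p + 2) → ℝ) → sobolevNat I n)
      (M : Lp ℝ 2 (volume.restrict (univ : Set ℝ)) →L[ℝ] Lp ℝ 2 (volume.restrict I)),
      (∀ u, M u =ᵐ[volume.restrict I] fun x => u x * bsplineDeriv k q σ x) ∧
      ∀ τ ∈ KnotVectors (p + 2), (W τ).1 0 = M (splineLp k p τ) ∧ DifferentiableAt ℝ W τ := by
  classical
  -- Derivatives of the second spline only act as bounded multipliers, so order `k + l = q`, where
  -- they are discontinuous, is still allowed.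
  have hM : ∀ l, ∃ M : Lp ℝ 2 (volume.restrict (univ : Set ℝ)) →L[ℝ] Lp ℝ 2 (volume.restrict I),
      ∀ u, M u =ᵐ[volume.restrict I] fun x => u x * splineSum (k + l) q σ x := fun l => by
    obtain ⟨K, hK⟩ := exists_abs_splineSum_le (n := k + l) hσ
    exact exists_multiplier I (measurable_splineSum _ _ _) hK
  choose M hM using hM
  let w : (Fin (p + 2) → ℝ) → PiLp 2 (fun _ : Fin (n + 1) => Lp ℝ 2 (volume.restrict I)) :=
    fun τ => WithLp.toLp 2 fun j => ∑ a ∈ Finset.HasAntidiagonal.antidiagonal (j : ℕ),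
      ((j : ℕ).choose a.1 : ℝ) • M a.2 (splineLp (k + a.1) p τ)
  have hac : volume.restrict I ≪ volume.restrict (univ : Set ℝ) :=
    Measure.absolutelyContinuous_of_le (Measure.restrict_mono_set volume (subset_univ I))
  have hw : ∀ τ ∈ KnotVectors (p + 2), w τ ∈ sobolevNat I n := fun τ hτ =>
    mem_sobolevNat_of_isPrimitive (H := leibnizSum k p q τ σ)
      (fun j => coeFn_sum_smul _ _ _ _ fun a _ => by
        filter_upwards [hM a.2 (splineLp (k + a.1) p τ),
          hac.ae_le (coeFn_splineLp (n := k + a.1) hτ)] with x h1 h2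
        rw [h1, h2])
      (fun j hj => isPrimitive_leibnizSum (by omega) (by omega) hτ hσ)
  refine ⟨fun τ => if hτ : τ ∈ KnotVectors (p + 2) then ⟨w τ, hw τ hτ⟩ else 0, M 0, fun u => ?_,
    fun τ hτ => ⟨?_, ?_⟩⟩
  · filter_upwards [hM 0 u, bsplineDeriv_ae_eq (n := k) (by omega) σ I] with x h1 h2
    rw [h1, h2, add_zero]
  · simp [hτ, w]
  · refine differentiableAt_sobolevNat fun j => ?_
    have : DifferentiableAt ℝ (fun τ => ∑ a ∈ Finset.HasAntidiagonal.antidiagonal (j : ℕ),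
        ((j : ℕ).choose a.1 : ℝ) • M a.2 (splineLp (k + a.1) p τ)) τ := by
      refine DifferentiableAt.fun_sum fun a ha => ?_
      have ha' := Finset.HasAntidiagonal.mem_antidiagonal.mp ha
      refine DifferentiableAt.fun_const_smul (𝕜 := ℝ) ?_ _
      exact (M a.2).differentiableAt.comp τ (differentiableAt_splineLp (by omega) hτ)
    refine this.congr_of_eventuallyEq ?_
    filter_upwards [eventually_mem_knotVectors hτ] with τ' h
    rw [dif_pos h]

theorem tendsto_update_nhds {N : ℕ} (τ : Fin N → ℝ) (i : Fin N) :
    Tendsto (fun t => Function.update τ i t) (𝓝 (τ i)) (𝓝 τ) := by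
  have : Continuous fun t => Function.update τ i t := continuous_const.update i continuous_id
  simpa using this.tendsto (τ i)

theorem HasFDerivAt.hasDerivAt_update {N : ℕ} {E : Type*} [NormedAddCommGroup E] [NormedSpace ℝ E]
    {U : (Fin N → ℝ) → E} {U' : (Fin N → ℝ) →L[ℝ] E} {τ : Fin N → ℝ} (h : HasFDerivAt U U' τ)
    (i : Fin N) :
    HasDerivAt (fun t => U (Function.update τ i t)) (U' (Pi.single i 1)) (τ i) := by
  have h1 := _root_.hasDerivAt_update τ i (τ i)
  have h2 : HasFDerivAt U U' (Function.update τ i (τ i)) := by rwa [Function.update_eq_self]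
  exact h2.comp_hasDerivAt (τ i) h1

/-- The main result in the case where the derivatives of the first B-spline are continuous. -/
theorem pairing_differentiable_of_lt (I : Set ℝ) {k p q m n : ℕ} (hm : p = k + m + 1) (hn : n ≤ m)
    (hq : k + n ≤ q) (f : Sobolev I (-(n : ℤ))) {σ : Fin (q + 2) → ℝ}
    (hσ : σ ∈ KnotVectors (q + 2)) :
    ∃ F : (Fin (p + 2) → ℝ) → ℝ,
      (∀ τ ∈ KnotVectors (p + 2), HasPairing I (-(n : ℤ)) f
        (fun x => bsplineDeriv k p τ x * bsplineDeriv k q σ x) (F τ)) ∧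
      ∀ τ ∈ KnotVectors (p + 2), DifferentiableAt ℝ F τ ∧
        ∀ i : Fin (p + 2), ∃ T : Sobolev univ (Int.ofNat m), IsKnotDeriv k p (Int.ofNat m) i τ T ∧
          ∃ a : ℝ, HasTriplePairing I (-(n : ℤ)) f (Int.ofNat m) T (bsplineDeriv k q σ) a ∧
            HasDerivAt (fun t => F (Function.update τ i t)) a (τ i) := by
  obtain ⟨L, hL⟩ := exists_pairing_functional I n f
  obtain ⟨W, M, hM, hW⟩ := exists_product_sobolevNat I (k := k) (p := p) (n := n) (by omega) hq hσ
  have hac : volume.restrict I ≪ volume.restrict (univ : Set ℝ) :=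
    Measure.absolutelyContinuous_of_le (Measure.restrict_mono_set volume (subset_univ I))
  have hkm : k + m < p := by omega
  refine ⟨fun τ => L (W τ), fun τ hτ => hL _ _ ?_, fun τ hτ => ?_⟩
  · rw [(hW τ hτ).1]
    filter_upwards [hM (splineLp k p τ), hac.ae_le (coeFn_splineLp (n := k) hτ),
      bsplineDeriv_ae_eq (n := k) (by omega) τ I] with x h1 h2 h3
    rw [h1, h2, h3]
  · have hWd := (hW τ hτ).2.hasFDerivAt
    have hUd := (differentiableAt_splineSobolev hkm hτ).hasFDerivAt
    have hFd := L.hasFDerivAt.comp τ hWd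
    refine ⟨hFd.differentiableAt, fun i => ?_⟩
    set T : sobolevNat univ m := fderiv ℝ (splineSobolev k m p hkm) τ (Pi.single i 1) with hT
    set w : sobolevNat I n := fderiv ℝ W τ (Pi.single i 1) with hw
    have hUi : HasDerivAt (fun t => splineSobolev k m p hkm (Function.update τ i t)) T (τ i) :=
      hUd.hasDerivAt_update i
    have hWi : HasDerivAt (fun t => W (Function.update τ i t)) w (τ i) := hWd.hasDerivAt_update i
    have hev : ∀ᶠ t in 𝓝 (τ i), Function.update τ i t ∈ KnotVectors (p + 2) :=
      (tendsto_update_nhds τ i).eventually (eventually_mem_knotVectors hτ)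
    refine ⟨T, ⟨fun t => splineSobolev k m p hkm (Function.update τ i t), ?_, hUi⟩, L w, ?_,
      hFd.hasDerivAt_update i⟩
    · filter_upwards [hev] with t ht
      change (splineSobolev k m p hkm (Function.update τ i t)).1 0 =ᵐ[volume.restrict univ] _
      rw [splineSobolev_apply hkm ht]
      exact (coeFn_splineLp ht).trans (bsplineDeriv_ae_eq (by omega) _ _).symm
    · refine hL w (fun x => T.1 0 x * bsplineDeriv k q σ x) ?_
      let PU : sobolevNat univ m →L[ℝ] Lp ℝ 2 (volume.restrict (univ : Set ℝ)) :=
        (PiLp.proj 2 _ 0).comp (sobolevNat univ m).subtypeL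
      let PW : sobolevNat I n →L[ℝ] Lp ℝ 2 (volume.restrict I) :=
        (PiLp.proj 2 _ 0).comp (sobolevNat I n).subtypeL
      have d1 := (M.comp PU).hasFDerivAt.comp_hasDerivAt (τ i) hUi
      have d2 := PW.hasFDerivAt.comp_hasDerivAt (τ i) hWi
      -- Both sides are the derivative of the same curve in `L²(I)`, obtained by applying bounded
      -- maps to the curves in `H^n(I)` and `H^m(ℝ)`. Uniqueness of derivatives identifies the
      -- derivative of the product with the product of the derivative.
      have e : w.1 0 = M (T.1 0) := by
        refine (d2.congr_of_eventuallyEq ?_).unique d1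
        filter_upwards [hev] with t ht
        change M ((splineSobolev k m p hkm (Function.update τ i t)).1 0) =
          (W (Function.update τ i t)).1 0
        rw [splineSobolev_apply hkm ht, (hW _ ht).1]
        rfl
      rw [e]
      exact hM (T.1 0)

/-! ### Continuous representatives of functions in `H¹(I)` -/

/-- A smooth function with zero mean, supported in an open interval, is the derivative of a test
function supported in this interval. -/
theorem exists_test_primitive {J : Set ℝ} (hJ : J.OrdConnected) {θ : ℝ → ℝ} (h1 : ContDiff ℝ ∞ θ)
    (h2 : HasCompactSupport θ) (h3 : tsupport θ ⊆ J) (h4 : ∫ x, θ x = 0) :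
    ∃ Φ : ℝ → ℝ, ContDiff ℝ ∞ Φ ∧ HasCompactSupport Φ ∧ tsupport Φ ⊆ J ∧ deriv Φ = θ := by
  rcases (tsupport θ).eq_empty_or_nonempty with he | hne
  · have : θ = 0 := tsupport_eq_empty_iff.mp he
    refine ⟨0, contDiff_const, HasCompactSupport.zero, ?_, ?_⟩
    · rw [tsupport_eq_empty_iff.mpr rfl]
      exact empty_subset J
    · rw [this]
      funext x
      simp
  · have hc : IsCompact (tsupport θ) := h2
    set a := sInf (tsupport θ) with ha
    set b := sSup (tsupport θ) with hb
    have hsub : tsupport θ ⊆ Icc a b := fun x hx =>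
      ⟨csInf_le hc.bddBelow hx, le_csSup hc.bddAbove hx⟩
    have hJab : Icc a b ⊆ J := hJ.out (h3 (hc.sInf_mem hne)) (h3 (hc.sSup_mem hne))
    have h0 : ∀ x, x ∉ Icc a b → θ x = 0 := fun x hx =>
      image_eq_zero_of_notMem_tsupport fun h => hx (hsub h)
    have hd : ∀ x, HasDerivAt (fun x => ∫ t in (a - 1)..x, θ t) (θ x) x := fun x =>
      intervalIntegral.integral_hasDerivAt_right (h1.continuous.intervalIntegrable _ _)
        (h1.continuous.stronglyMeasurableAtFilter _ _) h1.continuous.continuousAt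
    have hderiv : deriv (fun x => ∫ t in (a - 1)..x, θ t) = θ := funext fun x => (hd x).deriv
    have hz : ∀ x, x ∉ Icc a b → ∫ t in (a - 1)..x, θ t = 0 := by
      intro x hx
      rcases lt_or_ge x a with hxa | hxa
      · refine intervalIntegral.integral_zero_ae (Eventually.of_forall fun t ht => h0 t fun h => ?_)
        have := (uIoc_subset_uIcc ht)
        rcases le_total (a - 1) x with h' | h'
        · rw [uIcc_of_le h'] at this
          linarith [this.2, h.1]
        · rw [uIcc_of_ge h'] at this
          linarith [this.2, h.1]
      · have hxb : b < x := not_le.mp fun h => hx ⟨hxa, h⟩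
        rw [← integral_eq_intervalIntegral_of_forall_notMem (by linarith) fun t ht => h0 t fun h =>
          ht ⟨by linarith [h.1], by linarith [h.2]⟩, h4]
    have hts : tsupport (fun x => ∫ t in (a - 1)..x, θ t) ⊆ Icc a b :=
      closure_minimal (fun x hx => by
        by_contra h
        exact hx (hz x h)) isClosed_Icc
    refine ⟨fun x => ∫ t in (a - 1)..x, θ t, ?_, ?_, hts.trans hJab, hderiv⟩
    · rw [contDiff_infty_iff_deriv, hderiv]
      exact ⟨fun x => (hd x).differentiableAt, h1⟩
    · exact isCompact_Icc.of_isClosed_subset (isClosed_tsupport _) hts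

/-- A locally integrable function whose weak derivative vanishes on an open interval is constant
there. -/
theorem ae_eq_const_of_integral_mul_deriv_eq_zero {J : Set ℝ} (hJ : J.OrdConnected) (hJo : IsOpen J)
    {u : ℝ → ℝ} (hu : LocallyIntegrable u volume)
    (h : ∀ φ : ℝ → ℝ, ContDiff ℝ ∞ φ → HasCompactSupport φ → tsupport φ ⊆ J →
      ∫ x, u x * deriv φ x = 0) :
    ∃ c, ∀ᵐ x, x ∈ J → u x = c := by
  rcases J.eq_empty_or_nonempty with rfl | ⟨x₀, hx₀⟩
  · exact ⟨0, by simp⟩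
  obtain ⟨ε, hε, hball⟩ := Metric.nhds_basis_closedBall.mem_iff.mp (hJo.mem_nhds hx₀)
  -- A test function of integral one inside `J`; subtracting a multiple of it gives any test
  -- function zero mean, hence a compactly supported primitive.
  let b : ContDiffBump x₀ := ⟨ε / 2, ε, by positivity, by linarith⟩
  let φ₀ : ℝ → ℝ := b.normed volume
  have hφ1 : ContDiff ℝ ∞ φ₀ := b.contDiff_normed
  have hφ2 : HasCompactSupport φ₀ := b.hasCompactSupport_normed
  have hφ3 : tsupport φ₀ ⊆ J := by
    rw [b.tsupport_normed_eq]
    exact hball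
  have hφ4 : ∫ x, φ₀ x = 1 := b.integral_normed
  have hint : ∀ ψ : ℝ → ℝ, Continuous ψ → HasCompactSupport ψ →
      Integrable (fun x => u x * ψ x) volume := fun ψ hψ hc => by
    simpa only [smul_eq_mul, mul_comm] using hu.integrable_smul_left_of_hasCompactSupport hψ hc
  refine ⟨∫ x, u x * φ₀ x, ?_⟩
  have key := hJo.ae_eq_zero_of_integral_contDiff_smul_eq_zero
    (f := fun x => u x - ∫ x, u x * φ₀ x) (μ := volume)
    ((hu.sub (locallyIntegrable_const _)).locallyIntegrableOn J) ?_
  · filter_upwards [key] with x hx hxJ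
    linarith [hx hxJ]
  intro ψ h1 h2 h3
  set s := ∫ x, ψ x with hs
  have hψi := h1.continuous.integrable_of_hasCompactSupport h2 (μ := volume)
  have hφi := hφ1.continuous.integrable_of_hasCompactSupport hφ2 (μ := volume)
  have hsc : HasCompactSupport fun x => s * φ₀ x := hφ2.mul_left
  obtain ⟨Φ, k1, k2, k3, k4⟩ := exists_test_primitive hJ (θ := fun x => ψ x - s * φ₀ x)
    (h1.sub (contDiff_const.mul hφ1)) (h2.sub hsc)
    (closure_minimal (fun x hx => by
      by_contra hxJ
      have a1 : ψ x = 0 := image_eq_zero_of_notMem_tsupport fun h => hxJ (Or.inl h)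
      have a2 : φ₀ x = 0 := image_eq_zero_of_notMem_tsupport fun h => hxJ (Or.inr h)
      exact hx (by simp [a1, a2]))
      ((isClosed_tsupport ψ).union (isClosed_tsupport φ₀)) |>.trans (union_subset h3 hφ3))
    (by rw [integral_sub hψi (hφi.const_mul s), integral_const_mul, hφ4]; simp [hs])
  have e := h Φ k1 k2 k3
  rw [k4] at e
  have e2 : (fun x => u x * (ψ x - s * φ₀ x)) = fun x => u x * ψ x - s * (u x * φ₀ x) := by
    funext x
    ring
  rw [e2, integral_sub (hint ψ h1.continuous h2)
    ((hint φ₀ hφ1.continuous hφ2).const_mul s), integral_const_mul] at e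
  have e3 : (fun x => ψ x • (u x - ∫ x, u x * φ₀ x)) =
      fun x => u x * ψ x - (∫ x, u x * φ₀ x) * ψ x := by
    funext x
    rw [smul_eq_mul]
    ring
  rw [e3, integral_sub (hint ψ h1.continuous h2) (hψi.const_mul _), integral_const_mul]
  linarith

/-- An order-connected subset of `ℝ` is convex, so its frontier is a null set. -/
theorem restrict_interior_eq {I : Set ℝ} (hI : I.OrdConnected) :
    volume.restrict (interior I) = volume.restrict I :=
  Measure.restrict_congr_set (interior_ae_eq_of_null_frontier (hI.convex.addHaar_frontier volume))

/-- A function in `H¹(I)` is the restriction of a primitive of a locally integrable function. -/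
theorem exists_isPrimitive_of_sobolevNat {I : Set ℝ} (hI : I.OrdConnected) (w : sobolevNat I 1) :
    ∃ g g' : ℝ → ℝ, IsPrimitive g g' ∧ w.1 0 =ᵐ[volume.restrict I] g ∧
      w.1 1 =ᵐ[volume.restrict I] g' := by
  set J := interior I with hJdef
  have hr := restrict_interior_eq hI
  have hri : ∀ h : ℝ → ℝ, ∫ x in I, h x = ∫ x in J, h x := fun h => by rw [hr]
  have hJI : ∀ᵐ x ∂(volume.restrict I), x ∈ J := by
    rw [← hr]
    exact ae_restrict_mem isOpen_interior.measurableSet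
  have hJo : IsOpen J := isOpen_interior
  have hJ : J.OrdConnected := hI.convex.interior.ordConnected
  have hloc : ∀ u : Lp ℝ 2 (volume.restrict I), LocallyIntegrable (J.indicator u) volume := fun u => by
    have h1 : MemLp u 2 (volume.restrict J) := by
      rw [hr]
      exact Lp.memLp u
    exact ((memLp_indicator_iff_restrict hJo.measurableSet).mpr h1).locallyIntegrable (by norm_num)
  have P := IsPrimitive.of_locallyIntegrable (hloc (w.1 1)) 0 0
  set G : ℝ → ℝ := fun x => 0 + ∫ t in (0 : ℝ)..x, J.indicator (w.1 1) t with hG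
  have hInd : ∀ (v : Lp ℝ 2 (volume.restrict I)) (ψ : ℝ → ℝ),
      ∫ x, J.indicator v x * ψ x = ∫ x in I, v x * ψ x := by
    intro v ψ
    rw [hri, ← integral_indicator hJo.measurableSet]
    congr 1
    funext x
    by_cases hx : x ∈ J
    · simp [hx]
    · simp [hx]
  -- The function and the primitive `G` of its weak derivative have the same weak derivative on `J`,
  -- hence differ by a constant there.
  obtain ⟨c, hc⟩ := ae_eq_const_of_integral_mul_deriv_eq_zero hJ hJo
    (u := fun x => J.indicator (w.1 0) x - G x) ((hloc (w.1 0)).sub P.continuous.locallyIntegrable)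
    (by
      intro φ h1 h2 h3
      have hw := w.2 0 φ h1 h2 h3
      have hd : Continuous (deriv φ) := h1.continuous_deriv (by simp)
      have i1 : Integrable (fun x => J.indicator (w.1 0) x * deriv φ x) volume := by
        simpa only [smul_eq_mul, mul_comm] using
          (hloc (w.1 0)).integrable_smul_left_of_hasCompactSupport hd h2.deriv
      have i2 : Integrable (fun x => G x * deriv φ x) volume :=
        (P.continuous.mul hd).integrable_of_hasCompactSupport h2.deriv.mul_left
      simp only [sub_mul]
      rw [integral_sub i1 i2, P.integral_mul_deriv_test h1 h2,
        hInd, hInd]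
      have hw' : ∫ x in I, w.1 0 x * deriv φ x = -∫ x in I, w.1 1 x * φ x := hw
      rw [hw']
      ring)
  refine ⟨fun x => c + ∫ t in (0 : ℝ)..x, J.indicator (w.1 1) t, J.indicator (w.1 1),
    IsPrimitive.of_locallyIntegrable (hloc (w.1 1)) c 0, ?_, ?_⟩
  · filter_upwards [ae_restrict_of_ae hc, hJI] with x h1 h2
    have := h1 h2
    rw [indicator_of_mem h2] at this
    simp only [hG] at this
    linarith
  · filter_upwards [hJI] with x h2
    rw [indicator_of_mem h2]

/-! ### Step functions and point evaluations as functionals on `H¹(ℝ)` -/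

/-- The functional `u ↦ ∫ h u` on `L²`, depending linearly on `h`. -/
noncomputable def pairingCLM :
    Lp ℝ 2 (volume.restrict (univ : Set ℝ)) →L[ℝ] Lp ℝ 2 (volume.restrict (univ : Set ℝ)) →L[ℝ] ℝ :=
  (isBoundedBilinearMap_inner (𝕜 := ℝ)
    (E := Lp ℝ 2 (volume.restrict (univ : Set ℝ)))).toContinuousLinearMap

theorem pairingCLM_apply (h u : Lp ℝ 2 (volume.restrict (univ : Set ℝ))) :
    pairingCLM h u = ∫ x in univ, h x * u x := by
  change inner ℝ h u = _
  rw [L2.inner_def]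
  simp [mul_comm]

theorem integral_mul_cutPow (A : ℝ) (l : ℕ) {t : ℝ} (ht : A ≤ t) (g : ℝ → ℝ) :
    ∫ x, cutPow A l t x * g x = ∫ x in A..t, (t - x) ^ l * g x := by
  rw [intervalIntegral.integral_of_le ht, integral_Ioc_eq_integral_Ioo,
    ← integral_indicator measurableSet_Ioo]
  congr 1
  funext x
  by_cases hx : x ∈ Ioo A t
  · rw [indicator_of_mem hx, cutPow, if_pos hx.1, truncPow_of_pos _ (sub_pos.mpr hx.2)]
  · rw [indicator_of_notMem hx, cutPow_of_notMem A l hx, zero_mul]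

theorem pairingCLM_cutPowLp (A : ℝ) (l : ℕ) {t : ℝ} (ht : A ≤ t)
    {u : Lp ℝ 2 (volume.restrict (univ : Set ℝ))} {g : ℝ → ℝ}
    (hu : u =ᵐ[volume.restrict univ] g) :
    pairingCLM (cutPowLp univ A l t) u = ∫ x in A..t, (t - x) ^ l * g x := by
  rw [pairingCLM_apply, ← integral_mul_cutPow A l ht, ← setIntegral_univ (μ := volume)]
  refine integral_congr_ae ?_
  filter_upwards [hu, coeFn_cutPowLp univ A l t] with x h1 h2
  rw [h1, h2]

/-- An element of `L²(ℝ)` as a functional on a space `X` mapped to `L²(ℝ)` by `P`. -/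
noncomputable def dualCLM {X : Type*} [NormedAddCommGroup X] [NormedSpace ℝ X]
    (P : X →L[ℝ] Lp ℝ 2 (volume.restrict (univ : Set ℝ))) :
    Lp ℝ 2 (volume.restrict (univ : Set ℝ)) →L[ℝ] StrongDual ℝ X :=
  ((ContinuousLinearMap.compL ℝ X (Lp ℝ 2 (volume.restrict (univ : Set ℝ))) ℝ).flip P).comp
    pairingCLM

theorem isPrimitive_id_sub (a : ℝ) : IsPrimitive (fun x => x - a) (fun _ => 1) :=
  IsPrimitive.of_hasDerivAt (fun x => (hasDerivAt_id x).sub_const a) continuous_const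

/-- The linear maps `P₀`, `P₁` on `X` give the classes in `L²(ℝ)` of a function and of its weak
derivative. -/
def IsDerivPair {X : Type*} [NormedAddCommGroup X] [NormedSpace ℝ X]
    (P₀ P₁ : X →L[ℝ] Lp ℝ 2 (volume.restrict (univ : Set ℝ))) : Prop :=
  ∀ w, ∃ g g' : ℝ → ℝ, IsPrimitive g g' ∧ P₀ w =ᵐ[volume.restrict univ] g ∧
    P₁ w =ᵐ[volume.restrict univ] g'

theorem isDerivPair_sobolevNat : IsDerivPair
    ((PiLp.proj 2 _ 0).comp (sobolevNat univ 1).subtypeL)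
    ((PiLp.proj 2 _ 1).comp (sobolevNat univ 1).subtypeL) :=
  fun w => exists_isPrimitive_of_sobolevNat ordConnected_univ w

namespace IsDerivPair

variable {X : Type*} [NormedAddCommGroup X] [NormedSpace ℝ X]
  {P₀ P₁ : X →L[ℝ] Lp ℝ 2 (volume.restrict (univ : Set ℝ))}

theorem exists_isPrimitive (H : IsDerivPair P₀ P₁) {w : X} {g : ℝ → ℝ} (hg : Continuous g)
    (hw : P₀ w =ᵐ[volume.restrict univ] g) :
    ∃ g', IsPrimitive g g' ∧ P₁ w =ᵐ[volume.restrict univ] g' := by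
  obtain ⟨g₁, g', h1, h2, h3⟩ := H w
  have : g₁ = g := by
    have h4 := h2.symm.trans hw
    rw [Measure.restrict_univ] at h4
    exact (h1.continuous.ae_eq_iff_eq volume hg).mp h4
  exact ⟨g', this ▸ h1, h3⟩

/-- Evaluation at a point is a bounded functional. -/
theorem exists_eval_functional (H : IsDerivPair P₀ P₁) (A : ℝ) :
    ∃ δ : StrongDual ℝ X, ∀ (w : X) (g : ℝ → ℝ), Continuous g →
      P₀ w =ᵐ[volume.restrict univ] g → δ w = g A := by
  -- Integration by parts on `(A - 1, A)` gives `g(A) = ∫ g + ∫ g' - ∫ (A - x) g'`, and each term is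
  -- bounded by `L²` norms.
  refine ⟨dualCLM P₀ (cutPowLp univ (A - 1) 0 A) + dualCLM P₁ (cutPowLp univ (A - 1) 0 A) -
    dualCLM P₁ (cutPowLp univ (A - 1) 1 A), fun w g hg hw => ?_⟩
  obtain ⟨g', hP, hw1⟩ := H.exists_isPrimitive hg hw
  change pairingCLM (cutPowLp univ (A - 1) 0 A) (P₀ w) +
    pairingCLM (cutPowLp univ (A - 1) 0 A) (P₁ w) -
    pairingCLM (cutPowLp univ (A - 1) 1 A) (P₁ w) = g A
  rw [pairingCLM_cutPowLp _ _ (by linarith) hw,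
    pairingCLM_cutPowLp _ _ (by linarith) hw1, pairingCLM_cutPowLp _ _ (by linarith) hw1]
  have h1 := hP.integral_mul_eq (isPrimitive_id_sub A) (A - 1) A
  have h2 := hP.integral_eq (A - 1) A
  have h3 : ∫ x in (A - 1)..A, (A - x) ^ 1 * g' x = -∫ x in (A - 1)..A, g' x * (x - A) := by
    rw [← intervalIntegral.integral_neg]
    congr 1
    funext x
    ring
  rw [h3]
  simp only [pow_zero, one_mul, mul_one] at h1 ⊢
  rw [h1, h2]
  ring

/-- Integration by parts against `x - s` gives `∫_A^s g = (s - A) g(A) + ∫_A^s (s - x) g'`. The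
right-hand side involves a cut-off power of degree one, which is differentiable in `s` in `L²`. -/
theorem dualCLM_cutPowLp_eq (H : IsDerivPair P₀ P₁) {A s : ℝ} (hs : A ≤ s) {δ : StrongDual ℝ X}
    (hδ : ∀ (w : X) (g : ℝ → ℝ), Continuous g → P₀ w =ᵐ[volume.restrict univ] g → δ w = g A) :
    dualCLM P₀ (cutPowLp univ A 0 s) = (s - A) • δ + dualCLM P₁ (cutPowLp univ A 1 s) := by
  refine ContinuousLinearMap.ext fun w => ?_
  change pairingCLM (cutPowLp univ A 0 s) (P₀ w) =
    (s - A) * δ w + pairingCLM (cutPowLp univ A 1 s) (P₁ w)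
  obtain ⟨g, g', hP, hw, hw1⟩ := H w
  rw [hδ w g hP.continuous hw, pairingCLM_cutPowLp _ _ hs hw, pairingCLM_cutPowLp _ _ hs hw1]
  have h1 := hP.integral_mul_eq (isPrimitive_id_sub s) A s
  have h3 : ∫ x in A..s, (s - x) ^ 1 * g' x = -∫ x in A..s, g' x * (x - s) := by
    rw [← intervalIntegral.integral_neg]
    congr 1
    funext x
    ring
  rw [h3]
  simp only [pow_zero, one_mul, mul_one] at h1 ⊢
  rw [h1]
  ring

/-- As functionals, the derivative of the indicator function of `(A, t)` with respect to `t` is the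
evaluation at `t`. -/
theorem exists_hasDerivAt_dualCLM_cutPowLp (H : IsDerivPair P₀ P₁) {A t : ℝ} (ht : A < t) :
    ∃ δ : StrongDual ℝ X,
      HasDerivAt (fun s => dualCLM P₀ (cutPowLp univ A 0 s)) δ t ∧
      ∀ (w : X) (g : ℝ → ℝ), Continuous g → P₀ w =ᵐ[volume.restrict univ] g → δ w = g t := by
  obtain ⟨δ, hδ⟩ := H.exists_eval_functional A
  -- The derivative of the integrated form sends `w` to `g(A) + ∫_A^t g' = g(t)`.
  refine ⟨δ + dualCLM P₁ (cutPowLp univ A 0 t), ?_, fun w g hg hw => ?_⟩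
  · have h1 : HasDerivAt (fun s : ℝ => (s - A) • δ) ((1 : ℝ) • δ) t :=
      ((hasDerivAt_id t).sub_const A).smul_const δ
    rw [one_smul] at h1
    have h2 := hasDerivAt_cutPowLp univ A 0 t
    simp only [Nat.cast_zero, zero_add, one_smul] at h2
    refine (h1.add ((dualCLM P₁).hasFDerivAt.comp_hasDerivAt t h2)).congr_of_eventuallyEq ?_
    filter_upwards [Ioi_mem_nhds ht] with s hs
    exact H.dualCLM_cutPowLp_eq (le_of_lt hs) hδ
  · obtain ⟨g', hP, hw1⟩ := H.exists_isPrimitive hg hw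
    change δ w + pairingCLM (cutPowLp univ A 0 t) (P₁ w) = g t
    rw [hδ w g hg hw, pairingCLM_cutPowLp _ _ ht.le hw1]
    simp only [pow_zero, one_mul]
    rw [hP.integral_eq]
    ring

end IsDerivPair

/-! ### Derivatives with respect to a knot -/

/-- The partial derivative of the coefficient `knotCoeff p τ j` with respect to the `i`-th knot. -/
noncomputable def knotCoeffDeriv (p : ℕ) (τ : Fin (p + 2) → ℝ) (i j : Fin (p + 2)) : ℝ :=
  deriv (fun t => knotCoeff p (Function.update τ i t) j) (τ i)

theorem hasDerivAt_sum_knotCoeff_smul {E : Type*} [NormedAddCommGroup E] [NormedSpace ℝ E] {p : ℕ}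
    {τ : Fin (p + 2) → ℝ} (hτ : τ ∈ KnotVectors (p + 2)) (i : Fin (p + 2)) {Φ : ℝ → E} {Φ' : E}
    (hΦ : HasDerivAt Φ Φ' (τ i)) (C : ℝ) :
    HasDerivAt
      (fun t => C • ∑ j, knotCoeff p (Function.update τ i t) j • Φ (Function.update τ i t j))
      (C • (∑ j, knotCoeffDeriv p τ i j • Φ (τ j) + knotCoeff p τ i • Φ')) (τ i) := by
  have h1 : ∀ j, HasDerivAt (fun t => knotCoeff p (Function.update τ i t) j)
      (knotCoeffDeriv p τ i j) (τ i) := fun j =>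
    ((differentiableAt_knotCoeff hτ j).hasFDerivAt.hasDerivAt_update i).differentiableAt.hasDerivAt
  have h2 : ∀ j, HasDerivAt (fun t => Φ (Function.update τ i t j)) (if j = i then Φ' else 0)
      (τ i) := by
    intro j
    by_cases hj : j = i
    · subst hj
      simpa using hΦ
    · simpa [hj] using hasDerivAt_const (τ i) (Φ (τ j))
  refine HasDerivAt.fun_const_smul C ?_
  refine (HasDerivAt.fun_sum fun j (_ : j ∈ Finset.univ) => (h1 j).fun_smul (h2 j)).congr_deriv ?_
  rw [Finset.sum_add_distrib, add_comm]
  simp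

theorem eventually_lt_update_zero {p : ℕ} {τ : Fin (p + 2) → ℝ} {A : ℝ} (hA : A < τ 0)
    (i : Fin (p + 2)) : ∀ᶠ t in 𝓝 (τ i), A < Function.update τ i t 0 :=
  (tendsto_update_nhds τ i).eventually
    ((continuous_apply (A := fun _ : Fin (p + 2) => ℝ) 0).continuousAt.eventually_const_lt hA)

theorem eventually_update_mem_knotVectors {N : ℕ} {τ : Fin N → ℝ} (hτ : τ ∈ KnotVectors N)
    (i : Fin N) : ∀ᶠ t in 𝓝 (τ i), Function.update τ i t ∈ KnotVectors N :=
  (tendsto_update_nhds τ i).eventually (eventually_mem_knotVectors hτ)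

/-- The derivative of the `p`-th derivative of a B-spline of degree `p` with respect to a knot, in
the topology of functionals on `H¹(ℝ)`. -/
theorem IsDerivPair.exists_hasDerivAt_dualCLM_splineLp {X : Type*} [NormedAddCommGroup X]
    [NormedSpace ℝ X] {P₀ P₁ : X →L[ℝ] Lp ℝ 2 (volume.restrict (univ : Set ℝ))}
    (H : IsDerivPair P₀ P₁) {p : ℕ} {τ : Fin (p + 2) → ℝ} (hτ : τ ∈ KnotVectors (p + 2))
    {A : ℝ} (hA : A < τ 0) (i : Fin (p + 2)) :
    ∃ T : StrongDual ℝ X,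
      HasDerivAt (fun t => dualCLM P₀ (splineLp p p (Function.update τ i t))) T (τ i) ∧
      ∀ (w : X) (g : ℝ → ℝ), Continuous g → P₀ w =ᵐ[volume.restrict univ] g →
        T w = (-1) ^ p * p.descFactorial p *
          (∑ j, knotCoeffDeriv p τ i j * (∫ x in A..τ j, g x) + knotCoeff p τ i * g (τ i)) := by
  have hAj : ∀ j, A < τ j := fun j => hA.trans_le (hτ.monotone (Fin.zero_le j))
  obtain ⟨δ, hδ, hδ'⟩ := H.exists_hasDerivAt_dualCLM_cutPowLp (hAj i)
  refine ⟨_, (hasDerivAt_sum_knotCoeff_smul hτ i hδ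
    ((-1) ^ p * p.descFactorial p)).congr_of_eventuallyEq ?_, fun w g hg hw => ?_⟩
  · filter_upwards [eventually_lt_update_zero hA i, eventually_update_mem_knotVectors hτ i]
      with t h1 h2
    have e : splineLp p p (Function.update τ i t) = cutSplineLp A p p (Function.update τ i t) :=
      Lp.ext ((coeFn_splineLp h2).trans (coeFn_cutSplineLp h2 h1).symm)
    rw [e, cutSplineLp, map_smul, map_sum, Nat.sub_self]
    simp only [map_smul]
  · rw [_root_.smul_apply, _root_.add_apply, _root_.smul_apply, hδ' w g hg hw, smul_eq_mul,
      smul_eq_mul, _root_.sum_apply]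
    congr 2
    refine Finset.sum_congr rfl fun j _ => ?_
    rw [_root_.smul_apply, smul_eq_mul]
    congr 1
    have := pairingCLM_cutPowLp A 0 (hAj j).le hw
    simp only [pow_zero, one_mul] at this
    exact this

/-! ### Integrals over a bounded part of an interval, depending on an endpoint -/

/-- The fundamental theorem of calculus only needs an essential limit of the integrand equal to the
claimed derivative. Near an interior point the integrand is `u`, and near an exterior point it is
zero. At a frontier point the one-sided limit from within `I` must match the value zero outside. -/
theorem hasDerivAt_integral_indicator_interior {I : Set ℝ} (hI : I.OrdConnected) {u : ℝ → ℝ}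
    (hu : Continuous u) (A t : ℝ)
    (h : t ∈ frontier I → Tendsto u (𝓝 t ⊓ ae (volume.restrict I)) (𝓝 0)) :
    HasDerivAt (fun s => ∫ x in A..s, (interior I).indicator u x) ((interior I).indicator u t) t := by
  classical
  have hm : MeasurableSet (interior I) := isOpen_interior.measurableSet
  have hint : IntervalIntegrable ((interior I).indicator u) volume A t :=
    intervalIntegrable_iff.mpr ((intervalIntegrable_iff.mp (hu.intervalIntegrable A t)).indicator hm)
  refine intervalIntegral.integral_hasDerivAt_of_tendsto_ae_right hint
    ((hu.measurable.indicator hm).stronglyMeasurable.stronglyMeasurableAtFilter) ?_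
  by_cases hti : t ∈ interior I
  · rw [indicator_of_mem hti]
    refine (Tendsto.congr' ?_ hu.continuousAt).mono_left inf_le_left
    filter_upwards [isOpen_interior.mem_nhds hti] with x hx
    rw [indicator_of_mem hx]
  · rw [indicator_of_notMem hti]
    by_cases htc : t ∈ closure I
    · have h0 := h ⟨htc, hti⟩
      -- The filter is split into the part within `interior I`, handled by the hypothesis, and the
      -- complement, where the integrand is zero.
      rw [← restrict_interior_eq hI, ae_restrict_eq hm, ← inf_assoc] at h0
      rw [← piecewise_eq_indicator]
      exact h0.piecewise tendsto_const_nhds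
    · refine (tendsto_const_nhds.congr' ?_).mono_left inf_le_left
      filter_upwards [isClosed_closure.isOpen_compl.mem_nhds htc] with x hx
      rw [indicator_of_notMem fun h => hx (subset_closure (interior_subset h))]

theorem setIntegral_mul_cutPow {I : Set ℝ} (hI : I.OrdConnected) {A t : ℝ} (ht : A ≤ t)
    (u : ℝ → ℝ) :
    ∫ x in I, cutPow A 0 t x * u x = ∫ x in A..t, (interior I).indicator u x := by
  have hm : MeasurableSet (interior I) := isOpen_interior.measurableSet
  rw [← restrict_interior_eq hI, ← integral_indicator hm]
  have := integral_mul_cutPow A 0 ht ((interior I).indicator u)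
  simp only [pow_zero, one_mul] at this
  rw [← this]
  congr 1
  funext x
  by_cases hx : x ∈ interior I <;> simp [hx]

/-! ### Combinations of finite measures -/

theorem integrable_sum_smul_measure {ι : Type*} [Fintype ι] (μ : ι → Measure ℝ) (c : ι → ℝ)
    {h : ℝ → ℝ} (hh : ∀ i, Integrable h (μ i)) :
    Integrable h (∑ i, ENNReal.ofReal (c i) • μ i) :=
  integrable_finsetSum_measure.mpr fun i _ => (hh i).smul_measure ENNReal.ofReal_ne_top

theorem integral_sum_smul_measure {ι : Type*} [Fintype ι] (μ : ι → Measure ℝ) (c : ι → ℝ)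
    {h : ℝ → ℝ} (hh : ∀ i, Integrable h (μ i)) :
    ∫ x, h x ∂(∑ i, ENNReal.ofReal (c i) • μ i) = ∑ i, max (c i) 0 * ∫ x, h x ∂(μ i) := by
  rw [integral_finsetSum_measure fun i _ => (hh i).smul_measure ENNReal.ofReal_ne_top]
  refine Finset.sum_congr rfl fun i _ => ?_
  rw [integral_smul_measure, ENNReal.toReal_ofReal', smul_eq_mul]

/-- A real linear combination of finite measures is a difference of two finite measures. -/
theorem exists_measures_of_combination {ι : Type*} [Fintype ι] (μ : ι → Measure ℝ)
    [∀ i, IsFiniteMeasure (μ i)] (c : ι → ℝ) :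
    ∃ (μ₁ μ₂ : Measure ℝ) (_ : IsFiniteMeasure μ₁) (_ : IsFiniteMeasure μ₂),
      ∀ h : ℝ → ℝ, (∀ i, Integrable h (μ i)) → Integrable h μ₁ ∧ Integrable h μ₂ ∧
        (∫ x, h x ∂μ₁) - ∫ x, h x ∂μ₂ = ∑ i, c i * ∫ x, h x ∂(μ i) := by
  have hfin : ∀ d : ι → ℝ, IsFiniteMeasure (∑ i, ENNReal.ofReal (d i) • μ i) := fun d => by
    refine ⟨?_⟩
    rw [Measure.finsetSum_apply]
    exact ENNReal.sum_lt_top.mpr fun i _ => by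
      rw [Measure.smul_apply]
      exact ENNReal.mul_lt_top ENNReal.ofReal_lt_top (measure_lt_top _ _)
  -- Since `ENNReal.ofReal` truncates negative reals to zero, the coefficients `c` and `-c` collect
  -- the positive and negative parts.
  refine ⟨_, _, hfin c, hfin fun i => -c i, fun h hh => ⟨integrable_sum_smul_measure μ c hh,
    integrable_sum_smul_measure μ _ hh, ?_⟩⟩
  rw [integral_sum_smul_measure μ c hh, integral_sum_smul_measure μ _ hh, ← Finset.sum_sub_distrib]
  refine Finset.sum_congr rfl fun i _ => ?_
  rw [← sub_mul, max_zero_sub_max_neg_zero_eq_self]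

/-! ### The piecewise constant case -/

theorem integrable_cutPow_zero_mul (A t : ℝ) {u : ℝ → ℝ} (hu : Continuous u) :
    Integrable (fun x => cutPow A 0 t x * u x) volume := by
  have h := (hu.integrableOn_Icc (a := A) (b := t) (μ := volume)).mono_set Ioo_subset_Icc_self
  refine (h.integrable_indicator measurableSet_Ioo).congr (Eventually.of_forall fun x => ?_)
  by_cases hx : x ∈ Ioo A t
  · simp only
    rw [indicator_of_mem hx, cutPow, if_pos hx.1, truncPow_of_pos _ (sub_pos.mpr hx.2), pow_zero,
      one_mul]
  · simp only
    rw [indicator_of_notMem hx, cutPow_of_notMem A 0 hx, zero_mul]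

theorem setIntegral_splineSum_mul {I : Set ℝ} (hI : I.OrdConnected) {p : ℕ} {τ : Fin (p + 2) → ℝ}
    (hτ : τ ∈ KnotVectors (p + 2)) {A : ℝ} (hA : A < τ 0) {u : ℝ → ℝ} (hu : Continuous u) :
    IntegrableOn (fun x => splineSum p p τ x * u x) I ∧
    ∫ x in I, splineSum p p τ x * u x = ((-1) ^ p * p.descFactorial p : ℝ) •
      ∑ j, knotCoeff p τ j • ∫ x in A..τ j, (interior I).indicator u x := by
  have hAj : ∀ j, A ≤ τ j := fun j => (hA.trans_le (hτ.monotone (Fin.zero_le j))).le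
  have hi : ∀ j ∈ (Finset.univ : Finset (Fin (p + 2))), Integrable
      (fun x => knotCoeff p τ j * (cutPow A 0 (τ j) x * u x)) (volume.restrict I) := fun j _ =>
    ((integrable_cutPow_zero_mul A (τ j) hu).restrict).const_mul _
  have e : (fun x => splineSum p p τ x * u x) = fun x => ((-1) ^ p * p.descFactorial p : ℝ) *
      ∑ j, knotCoeff p τ j * (cutPow A 0 (τ j) x * u x) := by
    funext x
    rw [splineSum_eq_sum_cutPow hτ hA, mul_assoc, Finset.sum_mul, Nat.sub_self]
    simp only [mul_assoc]
  rw [e]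
  refine ⟨(integrable_finsetSum _ hi).const_mul _, ?_⟩
  rw [integral_const_mul, integral_finsetSum _ hi, smul_eq_mul]
  congr 1
  refine Finset.sum_congr rfl fun j _ => ?_
  rw [integral_const_mul, setIntegral_mul_cutPow hI (hAj j), smul_eq_mul]

theorem differentiableAt_sum_knotCoeff_smul {p : ℕ} {τ : Fin (p + 2) → ℝ}
    (hτ : τ ∈ KnotVectors (p + 2)) {G : ℝ → ℝ} (hG : ∀ j, DifferentiableAt ℝ G (τ j)) (C : ℝ) :
    DifferentiableAt ℝ (fun τ : Fin (p + 2) → ℝ => C • ∑ j, knotCoeff p τ j • G (τ j)) τ := by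
  refine DifferentiableAt.fun_const_smul (𝕜 := ℝ) ?_ _
  refine DifferentiableAt.fun_sum fun j _ => (differentiableAt_knotCoeff hτ j).fun_smul ?_
  have h : DifferentiableAt ℝ (fun τ : Fin (p + 2) → ℝ => τ j) τ := by fun_prop
  exact (hG j).comp τ h

/-- The combination of Lebesgue measures on intervals and of a Dirac measure representing the
derivative of a piecewise constant B-spline with respect to a knot. -/
theorem exists_knotDeriv_measures {p : ℕ} {τ : Fin (p + 2) → ℝ} {A : ℝ} (hA : ∀ j, A ≤ τ j)
    (i : Fin (p + 2)) (C : ℝ) :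
    ∃ (μ₁ μ₂ : Measure ℝ) (_ : IsFiniteMeasure μ₁) (_ : IsFiniteMeasure μ₂),
      ∀ h : ℝ → ℝ, (∀ j, IntegrableOn h (Ioo A (τ j))) →
        Integrable h μ₁ ∧ Integrable h μ₂ ∧ (∫ x, h x ∂μ₁) - ∫ x, h x ∂μ₂ =
          C * (∑ j, knotCoeffDeriv p τ i j * (∫ x in A..τ j, h x) + knotCoeff p τ i * h (τ i)) := by
  -- The index `none` carries the Dirac measure from moving the knot; `some j` carries the
  -- contribution of the changing coefficient `c_j`.
  let μ : Option (Fin (p + 2)) → Measure ℝ := fun o =>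
    o.elim (Measure.dirac (τ i)) fun j => volume.restrict (Ioo A (τ j))
  let c : Option (Fin (p + 2)) → ℝ := fun o =>
    o.elim (C * knotCoeff p τ i) fun j => C * knotCoeffDeriv p τ i j
  have hfin : ∀ o, IsFiniteMeasure (μ o) := by
    rintro (_ | j)
    · exact inferInstanceAs (IsFiniteMeasure (Measure.dirac (τ i)))
    · exact inferInstanceAs (IsFiniteMeasure (volume.restrict (Ioo A (τ j))))
  obtain ⟨μ₁, μ₂, f₁, f₂, H⟩ := exists_measures_of_combination μ c
  refine ⟨μ₁, μ₂, f₁, f₂, fun h hi => ?_⟩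
  obtain ⟨h1, h2, h3⟩ := H h (by
    rintro (_ | j)
    · exact integrable_dirac (by finiteness)
    · exact hi j)
  refine ⟨h1, h2, h3.trans ?_⟩
  rw [Fintype.sum_option]
  change C * knotCoeff p τ i * ∫ x, h x ∂(Measure.dirac (τ i)) +
    ∑ j, C * knotCoeffDeriv p τ i j * ∫ x in Ioo A (τ j), h x = _
  rw [integral_dirac, mul_add, Finset.mul_sum, add_comm]
  congr 1
  · refine Finset.sum_congr rfl fun j _ => ?_
    rw [intervalIntegral.integral_of_le (hA j), integral_Ioc_eq_integral_Ioo, mul_assoc]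
  · ring

/-- The main result in the case where the derivatives of the first B-spline are piecewise
constant. -/
theorem pairing_differentiable_of_eq {I : Set ℝ} (hI : I.OrdConnected) {p q : ℕ} (hpq : p < q)
    (f : Sobolev I (Int.ofNat 1)) (σ : Fin (q + 2) → ℝ) :
    ∃ F : (Fin (p + 2) → ℝ) → ℝ,
      (∀ τ ∈ KnotVectors (p + 2), HasPairing I (Int.ofNat 1) f
        (fun x => bsplineDeriv p p τ x * bsplineDeriv p q σ x) (F τ)) ∧
      ∀ τ ∈ KnotVectors (p + 2),
        (∀ j, τ j ∈ frontier I →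
          ProductVanishesAt I (Int.ofNat 1) f (bsplineDeriv p q σ) (τ j)) →
        DifferentiableAt ℝ F τ ∧
        ∀ i : Fin (p + 2), ∃ T : Sobolev univ (Int.negSucc 0),
          IsKnotDeriv p p (Int.negSucc 0) i τ T ∧
          ∃ a : ℝ, HasTriplePairing I (Int.ofNat 1) f (Int.negSucc 0) T (bsplineDeriv p q σ) a ∧
            HasDerivAt (fun t => F (Function.update τ i t)) a (τ i) := by
  let f' : sobolevNat I 1 := f
  obtain ⟨g, g', hP, hg, -⟩ := exists_isPrimitive_of_sobolevNat hI f'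
  have hv : Continuous (bsplineDeriv p q σ) := by
    rw [bsplineDeriv_eq_splineSum hpq]
    exact continuous_splineSum hpq σ
  set v := bsplineDeriv p q σ with hvdef
  have hu : Continuous fun x => g x * v x := hP.continuous.mul hv
  set u : ℝ → ℝ := fun x => g x * v x with hudef
  have hae : ∀ τ : Fin (p + 2) → ℝ, (fun x => f'.1 0 x * (bsplineDeriv p p τ x * v x))
      =ᵐ[volume.restrict I] fun x => splineSum p p τ x * u x := fun τ => by
    filter_upwards [hg, bsplineDeriv_ae_eq le_rfl τ I] with x h1 h2
    rw [h1, h2, hudef]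
    ring
  let F : (Fin (p + 2) → ℝ) → ℝ := fun τ => ∫ x in I, f'.1 0 x * (bsplineDeriv p p τ x * v x)
  have hF : ∀ (A : ℝ) (τ : Fin (p + 2) → ℝ), τ ∈ KnotVectors (p + 2) → A < τ 0 →
      F τ = ((-1) ^ p * p.descFactorial p : ℝ) •
        ∑ j, knotCoeff p τ j • ∫ x in A..τ j, (interior I).indicator u x := fun A τ hτ hA =>
    (integral_congr_ae (hae τ)).trans (setIntegral_splineSum_mul hI hτ hA hu).2
  refine ⟨F, fun τ hτ => ⟨?_, rfl⟩, fun τ hτ hvan => ?_⟩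
  · exact (setIntegral_splineSum_mul hI hτ (sub_one_lt (τ 0)) hu).1.congr (hae τ).symm
  set A := τ 0 - 1 with hAdef
  have hA : A < τ 0 := sub_one_lt (τ 0)
  have hAj : ∀ j, A ≤ τ j := fun j => (hA.trans_le (hτ.monotone (Fin.zero_le j))).le
  have hG : ∀ j, HasDerivAt (fun s => ∫ x in A..s, (interior I).indicator u x)
      ((interior I).indicator u (τ j)) (τ j) := fun j =>
    hasDerivAt_integral_indicator_interior hI hu A (τ j) fun hj => hvan j hj g hg
  refine ⟨?_, fun i => ?_⟩
  · refine (differentiableAt_sum_knotCoeff_smul hτ (fun j => (hG j).differentiableAt)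
      ((-1) ^ p * p.descFactorial p : ℝ)).congr_of_eventuallyEq ?_
    have hev : ∀ᶠ τ' : Fin (p + 2) → ℝ in 𝓝 τ, A < τ' 0 :=
      (continuous_apply 0).continuousAt.eventually_const_lt hA
    filter_upwards [eventually_mem_knotVectors hτ, hev] with τ' h1 h2
    exact hF A τ' h1 h2
  · obtain ⟨T, hT, hT'⟩ := isDerivPair_sobolevNat.exists_hasDerivAt_dualCLM_splineLp hτ hA i
    obtain ⟨μ₁, μ₂, f₁, f₂, hμ⟩ := exists_knotDeriv_measures hAj i
      ((-1) ^ p * p.descFactorial p : ℝ)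
    have hm : MeasurableSet (interior I) := isOpen_interior.measurableSet
    -- The identity for the measures holds for integrands that need not be continuous. For `u`
    -- extended by zero it yields exactly the number that the product rule gives as the derivative
    -- of `F`.
    obtain ⟨k1, k2, k3⟩ := hμ ((interior I).indicator u) fun j =>
      ((hu.integrableOn_Icc).mono_set Ioo_subset_Icc_self).indicator hm
    refine ⟨T, ⟨_, ?_, hT⟩, _, ⟨μ₁, μ₂, f₁, f₂, g, ?_, hP.continuous.continuousOn, hg,
      (integrable_indicator_iff hm).mp k1, (integrable_indicator_iff hm).mp k2, ?_⟩,
      (hasDerivAt_sum_knotCoeff_smul hτ i (hG i)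
        ((-1) ^ p * p.descFactorial p : ℝ)).congr_of_eventuallyEq ?_⟩
    · filter_upwards [eventually_update_mem_knotVectors hτ i] with t ht
      have e : splineLp p p (Function.update τ i t) =ᵐ[volume.restrict univ]
          bsplineDeriv p p (Function.update τ i t) :=
        (coeFn_splineLp ht).trans (bsplineDeriv_ae_eq le_rfl _ _).symm
      refine ⟨(memLp_congr_ae e).mp (Lp.memLp _), fun φ => ?_⟩
      refine (pairingCLM_apply _ _).trans (integral_congr_ae ?_)
      filter_upwards [e] with x hx
      rw [hx]
      rfl
    · intro φ w h1 h2 hw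
      refine (hT' w φ h1.continuous hw).trans
        (hμ φ fun j => ?_).2.2.symm
      exact (h1.continuous.integrableOn_Icc).mono_set Ioo_subset_Icc_self
    · rw [integral_indicator hm, integral_indicator hm] at k3
      exact k3
    · filter_upwards [eventually_lt_update_zero hA i, eventually_update_mem_knotVectors hτ i]
        with t h1 h2
      exact hF A _ h2 h1

theorem mainTheorem6 (I : Set ℝ) (hI : I.OrdConnected) (k p q : ℕ) (hp : k ≤ p) (hq : k ≤ q)
    (hpq : (p, q) ≠ (k, k)) (m r : ℤ) (hm : m = (p : ℤ) - k - 1) (hr : r = min m ((q : ℤ) - k))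
    (f : Sobolev I (-r)) (σ : Fin (q + 2) → ℝ) (hσ : σ ∈ KnotVectors (q + 2)) :
    ∃ F : (Fin (p + 2) → ℝ) → ℝ,
      (∀ τ ∈ KnotVectors (p + 2),
        HasPairing I (-r) f (fun x => bsplineDeriv k p τ x * bsplineDeriv k q σ x) (F τ)) ∧
      ∀ τ ∈ KnotVectors (p + 2),
        (p = k → ∀ j, τ j ∈ frontier I →
          ProductVanishesAt I (-r) f (bsplineDeriv k q σ) (τ j)) →
        DifferentiableAt ℝ F τ ∧
        ∀ i : Fin (p + 2), ∃ T : Sobolev univ m, IsKnotDeriv k p m i τ T ∧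
          ∃ a : ℝ, HasTriplePairing I (-r) f m T (bsplineDeriv k q σ) a ∧
            HasDerivAt (fun t => F (Function.update τ i t)) a (τ i) := by
  rcases hp.eq_or_lt with rfl | hkp
  · have hkq : k < q := lt_of_le_of_ne hq fun h => hpq (by rw [h])
    obtain rfl : m = Int.negSucc 0 := by
      rw [Int.negSucc_eq]
      omega
    have hs : -r = Int.ofNat 1 := by
      rw [hr, min_eq_left (by rw [Int.negSucc_eq]; omega)]
      rfl
    clear hr
    -- The type of `f` depends on `-r`, so the order becomes a variable before it is replaced by
    -- `1`.
    generalize -r = s at f hs ⊢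
    subst hs
    obtain ⟨F, h1, h2⟩ := pairing_differentiable_of_eq hI hkq f σ
    exact ⟨F, h1, fun τ hτ h => h2 τ hτ (h rfl)⟩
  · obtain ⟨m', hm'⟩ : ∃ m' : ℕ, p = k + m' + 1 := ⟨p - k - 1, by omega⟩
    obtain rfl : m = Int.ofNat m' := by
      rw [Int.ofNat_eq_natCast]
      omega
    -- The natural subtraction is exact because `k ≤ q`.
    obtain rfl : r = ((min m' (q - k) : ℕ) : ℤ) := by
      rw [hr, Int.ofNat_eq_natCast]
      omega
    obtain ⟨F, h1, h2⟩ := pairing_differentiable_of_lt I hm' (min_le_left m' (q - k))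
      (by omega) f hσ
    exact ⟨F, h1, fun τ hτ _ => h2 τ hτ⟩
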